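/- Let $d\ge 0$ be an integer, let $\|\cdot\|$ be a norm on $\mathbf R^d$, and put $\mathbf S_+^{d-1}=\{\boldsymbol u\in[0,\infty)^d:\|\boldsymbol u\|=1\}$; assume that $\mathbf S_+^{d-1}\subseteq[0,1]^d$. Powers, maxima and inequalities of vectors are understood coordinatewise. **Max-stable laws.** For $\alpha>0$ and a finite Borel measure $\nu$ on $\mathbf S_+^{d-1}$ with $\int u^j\,d\nu(\boldsymbol u)=1$ for $j=1,\dots,d$ (the moment constraints), let $\mu_{\alpha,\nu}$ be the image of the measure $r^{-2}\,dr\otimes d\nu(\boldsymbol u)$ on $(0,\infty)\times\mathbf S_+^{d-1}$ under $(r,\boldsymbol u)\mapsto (r\boldsymbol u)^{1/\alpha}$ (the exponent measure). A random vector $\boldsymbol Z$ with values in $(0,\infty)^d$ has the max-stable distribution $\mathcal{MS}(\alpha,\nu)$ if $$\mathbb P(\boldsymbol Z\le \boldsymbol z)=\exp\big(-\mu_{\alpha,\nu}([\boldsymbol 0,\boldsymbol z]^c)\big)\qquad\text{for all }\boldsymbol z\in(0,\infty)^d .$$ Equivalently, $\boldsymbol Z$ is distributed as the coordinatewise maximum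 of a Poisson process with intensity $\mu_{\alpha,\nu}$. The Fréchet distribution $\mathcal F(\alpha)$ has c.d.f. $e^{-x^{-\alpha}}$ for $x>0$ and $0$ for $x\le 0$. **Distances.** For random vectors $\boldsymbol X,\boldsymbol Y$, $$d_K(\boldsymbol X,\boldsymbol Y)=\sup_{\boldsymbol z\in(0,\infty)^d}|\mathbb P(\boldsymbol X\le\boldsymbol z)-\mathbb P(\boldsymbol Y\le\boldsymbol z)|,\qquad d_W(\boldsymbol X,\boldsymbol Y)=\sup_{h}|\mathbb E h(\boldsymbol X)-\mathbb E h(\boldsymbol Y)|,$$ the second supremum being over all $h:[0,\infty)^d\to\mathbf R$ that are $1$-Lipschitz for the $\ell^1$ norm; the smooth Wasserstein distance $d_W^{\,s}$ is defined in the same way, with $h$ in addition of class $C^1$ on $[0,\infty)^d$. For finite measures, $d_{TV}(\nu_1,\nu_2)=\int|f_1-f_2|\,d(\nu_1+\nu_2)$ with $f_i=d\nu_i/d(\nu_1+\nu_2)$. **Statement.** Let $0<\alpha_1<\alpha_2$, let $\nu_1,\nu_2$ be finite measures on $\mathbf S_+^{d-1}$ satisfying the moment constraints, and let $\boldsymbol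 Z_i\sim\mathcal{MS}(\alpha_i,\nu_i)$, $i=1,2$. Let $Z\sim\mathcal F(\alpha_1)$, $p(t)=\mathbb P(\min(Z^{\alpha_2/\alpha_1},Z)\le t)$ and $\mu=\mu_{\alpha_1,\nu_1}$. (Below, integrands are $0$ where $y^j=0$.) (i) The constant $$C^K=d+\sum_{j=1}^d\int|\log y^j|\,p(y^j)\,d\mu(\boldsymbol y)$$ is finite, and $$d_K(\boldsymbol Z_1,\boldsymbol Z_2)\le C^K\Big(\frac1{\alpha_1}+\frac1{\alpha_2}\Big)|\alpha_1-\alpha_2|+d\,d_{TV}(\nu_1,\nu_2).$$ (ii) If moreover $\alpha_1>1$ (hence $\alpha_2>1$), then the constant $$C^W=d\,\Gamma\Big(1-\frac1{\alpha_1}\Big)+\sum_{j=1}^d\int\max(1,y^j)\,|\log y^j|\,p(y^j)\,d\mu(\boldsymbol y)$$ is finite, and $$d_W(\boldsymbol Z_1,\boldsymbol Z_2)\le C^W\Big(\frac1{\alpha_1}+\frac1{\alpha_2}\Big)|\alpha_1-\alpha_2|+d\,\Gamma\Big(1-\frac1{\alpha_2}\Big)d_{TV}(\nu_1,\nu_2);$$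 the same bound holds for $d_W^{\,s}(\boldsymbol Z_1,\boldsymbol Z_2)$. -/

import Mathlib

open MeasureTheory Set
open scoped ENNReal

namespace MaxStable

noncomputable section

/-- The open positive orthant `(0, +∞)^d`. -/
def posOrthant (d : ℕ) : Set (Fin d → ℝ) := {x | ∀ j, 0 < x j}

/-- The closed positive orthant `[0, +∞)^d`. -/
def orthant (d : ℕ) : Set (Fin d → ℝ) := {x | ∀ j, 0 ≤ x j}

/-- The part of the unit sphere of the norm `N` that lies in the closed positive orthant. -/
def posSphere {d : ℕ} (N : Seminorm ℝ (Fin d → ℝ)) : Set (Fin d → ℝ) :=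
  {x | x ∈ orthant d ∧ N x = 1}

/-- The measure `ρ` on `(0, +∞)` with `ρ [x, +∞) = 1 / x`, that is `dρ(r) = r⁻² dr`. -/
def radialMeasure : Measure ℝ :=
  (volume.restrict (Ioi 0)).withDensity fun r => ENNReal.ofReal (1 / r ^ 2)

/-- The polar map `(r, u) ↦ (r u)^(1/α)`, the power being taken coordinatewise. -/
def polarMap {d : ℕ} (N : Seminorm ℝ (Fin d → ℝ)) (α : ℝ) (p : ℝ × posSphere N) : Fin d → ℝ :=
  fun j => (p.1 * (p.2 : Fin d → ℝ) j) ^ (1 / α)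

/-- The exponent measure with stability index `α` and angular measure `ν`: the image of `ρ ⊗ ν`
under the polar map. It is concentrated on `[0, +∞)^d ∖ {0}`. -/
def exponentMeasure {d : ℕ} {N : Seminorm ℝ (Fin d → ℝ)} (α : ℝ) (ν : Measure (posSphere N)) :
    Measure (Fin d → ℝ) :=
  (radialMeasure.prod ν).map (polarMap N α)

/-- The moment constraints `∫ u^j dν(u) = 1` for all `j`. -/
def MomentConstraints {d : ℕ} {N : Seminorm ℝ (Fin d → ℝ)} (ν : Measure (posSphere N)) : Prop :=
  ∀ j : Fin d, ∫ u, (u : Fin d → ℝ) j ∂ν = 1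

/-- `Z ∼ MS(α, ν)`: the random vector `Z`, with positive coordinates, has the max-stable law whose
exponent measure is `μ = exponentMeasure α ν`, i.e. `P(Z ≤ z) = exp (-μ([0, z]ᶜ))` for `z > 0`.
(The right-hand side is the probability that a Poisson process of intensity `μ` has no point
outside `[0, z]`, i.e. that the coordinatewise maximum of its points is at most `z`.) -/
structure IsMaxStable {d : ℕ} {N : Seminorm ℝ (Fin d → ℝ)} (α : ℝ) (ν : Measure (posSphere N))
    {Ω : Type*} [MeasurableSpace Ω] (P : Measure Ω) (Z : Ω → Fin d → ℝ) : Prop where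
  aemeasurable : AEMeasurable Z P
  pos : ∀ᵐ ω ∂P, Z ω ∈ posOrthant d
  cdf : ∀ z ∈ posOrthant d,
    P.real {ω | Z ω ≤ z} = Real.exp (-(exponentMeasure α ν).real (Icc 0 z)ᶜ)

/-- The Fréchet distribution `F(α)`, with c.d.f. `exp (-x^(-α))` for `x > 0` and `0` for `x ≤ 0`,
given by its density. -/
def frechet (α : ℝ) : Measure ℝ :=
  (volume.restrict (Ioi 0)).withDensity fun x =>
    ENNReal.ofReal (α * x ^ (-(α + 1)) * Real.exp (-x ^ (-α)))

/-- The Kolmogorov distance between the laws of two random vectors with positive coordinates. -/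
def kolmogorovDist {d : ℕ} {Ω₁ Ω₂ : Type*} [MeasurableSpace Ω₁] [MeasurableSpace Ω₂]
    (P₁ : Measure Ω₁) (X : Ω₁ → Fin d → ℝ) (P₂ : Measure Ω₂) (Y : Ω₂ → Fin d → ℝ) : ℝ≥0∞ :=
  ⨆ z ∈ posOrthant d, ENNReal.ofReal |P₁.real {ω | X ω ≤ z} - P₂.real {ω | Y ω ≤ z}|

/-- Functions that are `1`-Lipschitz on the closed positive orthant for the `ℓ¹` norm. -/
def lipOne (d : ℕ) : Set ((Fin d → ℝ) → ℝ) :=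
  {h | ∀ x ∈ orthant d, ∀ y ∈ orthant d, |h x - h y| ≤ ∑ j, |x j - y j|}

/-- Functions of class `C¹` on the closed positive orthant that are `1`-Lipschitz there. -/
def smoothLipOne (d : ℕ) : Set ((Fin d → ℝ) → ℝ) :=
  {h | ContDiffOn ℝ 1 h (orthant d) ∧ h ∈ lipOne d}

/-- The integral probability metric `sup_{h ∈ H} |E h(X) - E h(Y)|` of a class `H` of functions. -/
def distOver {d : ℕ} (H : Set ((Fin d → ℝ) → ℝ)) {Ω₁ Ω₂ : Type*} [MeasurableSpace Ω₁]
    [MeasurableSpace Ω₂] (P₁ : Measure Ω₁) (X : Ω₁ → Fin d → ℝ) (P₂ : Measure Ω₂)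
    (Y : Ω₂ → Fin d → ℝ) : ℝ≥0∞ :=
  ⨆ h ∈ H, ENNReal.ofReal |∫ ω, h (X ω) ∂P₁ - ∫ ω, h (Y ω) ∂P₂|

/-- The Wasserstein distance between the laws of two random vectors. -/
def wassersteinDist {d : ℕ} {Ω₁ Ω₂ : Type*} [MeasurableSpace Ω₁] [MeasurableSpace Ω₂]
    (P₁ : Measure Ω₁) (X : Ω₁ → Fin d → ℝ) (P₂ : Measure Ω₂) (Y : Ω₂ → Fin d → ℝ) : ℝ≥0∞ :=
  distOver (lipOne d) P₁ X P₂ Y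

/-- The smooth Wasserstein distance between the laws of two random vectors. -/
def smoothWassersteinDist {d : ℕ} {Ω₁ Ω₂ : Type*} [MeasurableSpace Ω₁] [MeasurableSpace Ω₂]
    (P₁ : Measure Ω₁) (X : Ω₁ → Fin d → ℝ) (P₂ : Measure Ω₂) (Y : Ω₂ → Fin d → ℝ) : ℝ≥0∞ :=
  distOver (smoothLipOne d) P₁ X P₂ Y

/-- The total variation distance `∫ |f₁ - f₂| d(ν₁ + ν₂)`, where `fᵢ` is the density of `νᵢ` with
respect to `ν₁ + ν₂`. -/
def tvDist {S : Type*} [MeasurableSpace S] (ν₁ ν₂ : Measure S) : ℝ≥0∞ :=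
  ∫⁻ u, ENNReal.ofReal
    |(ν₁.rnDeriv (ν₁ + ν₂) u).toReal - (ν₂.rnDeriv (ν₁ + ν₂) u).toReal| ∂(ν₁ + ν₂)

/-- `P(min(Z^(α₂/α₁), Z) ≤ t)` for `Z` with the Fréchet distribution `F(α₁)`. -/
def minProb (α₁ α₂ t : ℝ) : ℝ≥0∞ := frechet α₁ {x | min (x ^ (α₂ / α₁)) x ≤ t}

/-- The constant
`C^K = d + ∑_j ∫ |log y^j| P(min(Z^(α₂/α₁), Z) ≤ y^j) dμ(y)`, `Z ∼ F(α₁)`,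
with `μ` the exponent measure of `MS(α₁, ν)`. (The integrand vanishes where `y^j = 0`.) -/
def constK {d : ℕ} {N : Seminorm ℝ (Fin d → ℝ)} (α₁ α₂ : ℝ) (ν : Measure (posSphere N)) : ℝ≥0∞ :=
  d + ∑ j : Fin d, ∫⁻ y, ENNReal.ofReal |Real.log (y j)| * minProb α₁ α₂ (y j)
    ∂(exponentMeasure α₁ ν)

/-- The constant
`C^W = d Γ(1 - 1/α₁) + ∑_j ∫ max(1, y^j) |log y^j| P(min(Z^(α₂/α₁), Z) ≤ y^j) dμ(y)`,
`Z ∼ F(α₁)`, with `μ` the exponent measure of `MS(α₁, ν)`. -/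
def constW {d : ℕ} {N : Seminorm ℝ (Fin d → ℝ)} (α₁ α₂ : ℝ) (ν : Measure (posSphere N)) : ℝ≥0∞ :=
  d * ENNReal.ofReal (Real.Gamma (1 - 1 / α₁)) +
    ∑ j : Fin d, ∫⁻ y, ENNReal.ofReal (max 1 (y j) * |Real.log (y j)|) * minProb α₁ α₂ (y j)
      ∂(exponentMeasure α₁ ν)

end

end MaxStable

/-! The pivot is the coordinatewise power `Z₁^(α₁/α₂)`, whose law is `MS(α₂, ν₁)`
(`IsMaxStable.map_rpow`). The triangle inequality splits each distance into a change of index at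
fixed `ν₁` and a change of angular measure at fixed index `α₂`.

Index. For the Kolmogorov distance, the two c.d.f.s are one c.d.f. at `z` and at `z^(α₂/α₁)`. A
union bound reduces to Fréchet marginals, and `y |log y| e^(-y) ≤ 1` controls `exp (-x^s)` as `s`
varies. For the Wasserstein distance, `Z₁` is coupled with its own power and `abs_sub_rpow_le`
bounds the cost. Its Fréchet mean is at most the integral in `constW`, because the Fréchet density
is the marginal density of `μ` times `P(Z ≤ t)` (`mul_lintegral_frechet_le_constW`).

Angular measure. Write `ν₁ + b = ν₂ + a` with `a`, `b` the parts of `ν₁ - ν₂`, of total mass `tvDist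
ν₁ ν₂`. The c.d.f.s are `exp (-tail)`; both tails are at least `m = max_j (z^j)^(-α)` and differ by
at most `m` times that mass, and `m e^(-m) ≤ 1`. For the Wasserstein distance, adjoining to each
vector an independent Poisson maximum, with angular measure `b` or `a`, produces one common law.
Each adjunction costs at most `d Γ(1 - 1/α)` times the added mass, up to a truncation level `δ → 0`.
-/

namespace MaxStable

/-! ### Fréchet distributions. -/

/-- Change of variables `s = k * t ^ p` on the half-line. -/
theorem lintegral_comp_mul_rpow_Ioi {k p : ℝ} (hk : 0 < k) (hp : p ≠ 0) (g : ℝ → ℝ≥0∞) :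
    ∫⁻ t in Ioi (0 : ℝ), ENNReal.ofReal (k * (|p| * t ^ (p - 1))) * g (k * t ^ p)
      = ∫⁻ s in Ioi (0 : ℝ), g s := by
  have himg : (fun t : ℝ => k * t ^ p) '' Ioi 0 = Ioi 0 := by
    ext s
    constructor
    · rintro ⟨t, ht, rfl⟩
      exact mul_pos hk (Real.rpow_pos_of_pos ht _)
    · intro hs
      refine ⟨(s / k) ^ p⁻¹, Real.rpow_pos_of_pos (div_pos hs hk) _, ?_⟩
      simp only
      rw [← Real.rpow_mul (div_pos hs hk).le, inv_mul_cancel₀ hp, Real.rpow_one]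
      field_simp
  have hinj : InjOn (fun t : ℝ => k * t ^ p) (Ioi 0) := by
    intro a ha b hb hab
    have h : a ^ p = b ^ p := mul_left_cancel₀ hk.ne' hab
    exact Real.rpow_left_injOn hp (mem_Ioi.1 ha).le (mem_Ioi.1 hb).le h
  have hderiv : ∀ t ∈ Ioi (0 : ℝ),
      HasDerivWithinAt (fun t : ℝ => k * t ^ p) (k * (p * t ^ (p - 1))) (Ioi 0) t := fun t ht =>
    ((Real.hasDerivAt_rpow_const (Or.inl (ne_of_gt ht))).const_mul k).hasDerivWithinAt
  have := lintegral_image_eq_lintegral_abs_deriv_mul measurableSet_Ioi hderiv hinj g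
  rw [himg] at this
  rw [this]
  refine setLIntegral_congr_fun measurableSet_Ioi fun t ht => ?_
  have h0 : 0 < t ^ (p - 1) := Real.rpow_pos_of_pos ht _
  simp only [abs_mul, abs_of_pos hk, abs_of_pos h0]

theorem measurable_frechetDensity (α : ℝ) : Measurable fun x : ℝ =>
    ENNReal.ofReal (α * x ^ (-(α + 1)) * Real.exp (-x ^ (-α))) := by fun_prop

theorem lintegral_frechet {α : ℝ} {g : ℝ → ℝ≥0∞} (hg : Measurable g) :
    ∫⁻ x, g x ∂(frechet α) = ∫⁻ x in Ioi (0 : ℝ),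
      ENNReal.ofReal (α * x ^ (-(α + 1)) * Real.exp (-x ^ (-α))) * g x :=
  lintegral_withDensity_eq_lintegral_mul _ (measurable_frechetDensity α) hg

/-- A Fréchet variable is the power `-1/α` of an exponential variable. -/
theorem lintegral_frechet_comp {α : ℝ} (hα : 0 < α) {g : ℝ → ℝ≥0∞} (hg : Measurable g) :
    ∫⁻ x, g (x ^ (-α)) ∂(frechet α)
      = ∫⁻ s in Ioi (0 : ℝ), ENNReal.ofReal (Real.exp (-s)) * g s := by
  rw [lintegral_frechet (g := fun x => g (x ^ (-α))) (hg.comp (by fun_prop)),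
    ← lintegral_comp_mul_rpow_Ioi one_pos (neg_ne_zero.2 hα.ne')
      fun s => ENNReal.ofReal (Real.exp (-s)) * g s]
  refine setLIntegral_congr_fun measurableSet_Ioi fun t ht => ?_
  have h0 : 0 < t ^ (-α - 1) := Real.rpow_pos_of_pos ht _
  simp only [one_mul, abs_neg, abs_of_pos hα]
  rw [← mul_assoc, ← ENNReal.ofReal_mul (by positivity)]
  congr 4
  ring_nf

theorem frechet_Iic {α : ℝ} (hα : 0 < α) {x : ℝ} (hx : 0 < x) :
    frechet α (Iic x) = ENNReal.ofReal (Real.exp (-x ^ (-α))) := by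
  have h1 := lintegral_frechet_comp hα
    (measurable_one.indicator measurableSet_Ici : Measurable ((Ici (x ^ (-α))).indicator 1))
  have h2 : ∫⁻ t, (Ici (x ^ (-α))).indicator 1 (t ^ (-α)) ∂(frechet α) = frechet α (Iic x) := by
    rw [← lintegral_indicator_one measurableSet_Iic]
    refine lintegral_congr_ae ?_
    have : ∀ᵐ t ∂(frechet α), t ∈ Ioi (0 : ℝ) :=
      (withDensity_absolutelyContinuous _ _).ae_le (ae_restrict_mem measurableSet_Ioi)
    filter_upwards [this] with t ht
    have : x ^ (-α) ≤ t ^ (-α) ↔ t ≤ x :=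
      Real.rpow_le_rpow_iff_of_neg hx ht (neg_neg_of_pos hα)
    simp [indicator, this]
  rw [← h2, h1]
  have hpos : 0 < x ^ (-α) := Real.rpow_pos_of_pos hx _
  have h3 : ∫⁻ s in Ioi (0 : ℝ), ENNReal.ofReal (Real.exp (-s)) * (Ici (x ^ (-α))).indicator 1 s
      = ∫⁻ s in Ioi (x ^ (-α)), ENNReal.ofReal (Real.exp (-s)) := by
    rw [setLIntegral_congr (Ioi_ae_eq_Ici (a := x ^ (-α))), ← lintegral_indicator measurableSet_Ici,
      ← lintegral_indicator measurableSet_Ioi]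
    refine lintegral_congr fun s => ?_
    by_cases hs : x ^ (-α) ≤ s
    · simp [indicator, hs, hpos.trans_le hs]
    · simp [indicator, hs]
  rw [h3, ← ofReal_integral_eq_lintegral_ofReal (integrableOn_exp_neg_Ioi _)
    (Filter.Eventually.of_forall fun s => (Real.exp_pos _).le), integral_exp_neg_Ioi]

theorem frechet_Iic_of_nonpos {α x : ℝ} (hx : x ≤ 0) : frechet α (Iic x) = 0 := by
  refine withDensity_absolutelyContinuous _ _ ?_
  rw [Measure.restrict_apply measurableSet_Iic]
  convert measure_empty (μ := (volume : Measure ℝ))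
  ext t
  simp only [mem_inter_iff, mem_Iic, mem_Ioi, mem_empty_iff_false, iff_false, not_and, not_lt]
  exact fun h => h.trans hx

theorem frechet_univ {α : ℝ} (hα : 0 < α) : frechet α univ = 1 := by
  have h1 := lintegral_frechet_comp hα (measurable_const (a := (1 : ℝ≥0∞)))
  simp only [lintegral_const, one_mul, mul_one] at h1
  rw [h1, ← ofReal_integral_eq_lintegral_ofReal (integrableOn_exp_neg_Ioi _)
    (Filter.Eventually.of_forall fun s => (Real.exp_pos _).le), integral_exp_neg_Ioi]
  simp

/-- The first moment of the Fréchet distribution. -/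
theorem lintegral_id_frechet {α : ℝ} (hα : 1 < α) :
    ∫⁻ x, ENNReal.ofReal x ∂(frechet α) = ENNReal.ofReal (Real.Gamma (1 - 1 / α)) := by
  have hα0 : 0 < α := by linarith
  have hs : 0 < 1 - 1 / α := by
    rw [sub_pos, div_lt_one hα0]; exact hα
  have h1 := lintegral_frechet_comp hα0 (g := fun s => ENNReal.ofReal (s ^ (-1 / α)))
    (by fun_prop)
  have h2 : ∫⁻ x, ENNReal.ofReal x ∂(frechet α)
      = ∫⁻ x, ENNReal.ofReal ((x ^ (-α)) ^ (-1 / α)) ∂(frechet α) := by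
    refine lintegral_congr_ae ?_
    have : ∀ᵐ t ∂(frechet α), t ∈ Ioi (0 : ℝ) :=
      (withDensity_absolutelyContinuous _ _).ae_le (ae_restrict_mem measurableSet_Ioi)
    filter_upwards [this] with t ht
    rw [← Real.rpow_mul (mem_Ioi.1 ht).le]
    rw [show -α * (-1 / α) = 1 by field_simp, Real.rpow_one]
  rw [h2, h1, Real.Gamma_eq_integral hs, ofReal_integral_eq_lintegral_ofReal
    (Real.GammaIntegral_convergent hs)]
  · refine setLIntegral_congr_fun measurableSet_Ioi fun t ht => ?_
    rw [← ENNReal.ofReal_mul (Real.exp_pos _).le]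
    congr 3
    ring
  · filter_upwards [ae_restrict_mem measurableSet_Ioi] with t ht
    exact mul_nonneg (Real.exp_pos _).le (Real.rpow_nonneg (mem_Ioi.1 ht).le _)

/-- The integrand is `1/α` times `t` times the Fréchet density, and the factor `1/α ≤ 1` is given
away. -/
theorem lintegral_rpow_mul_exp_le {α : ℝ} (hα : 1 < α) :
    ∫⁻ t in Ioi (0 : ℝ), ENNReal.ofReal (Real.exp (-t ^ (-α)) * t ^ (-α))
      ≤ ENNReal.ofReal (Real.Gamma (1 - 1 / α)) := by
  rw [← lintegral_id_frechet hα, lintegral_frechet (by fun_prop)]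
  refine setLIntegral_mono' measurableSet_Ioi fun t ht => ?_
  have ht : 0 < t := ht
  rw [← ENNReal.ofReal_mul (by positivity)]
  refine ENNReal.ofReal_le_ofReal ?_
  have : t ^ (-(α + 1)) * t = t ^ (-α) := by
    rw [← Real.rpow_add_one ht.ne']; congr 1; ring
  calc Real.exp (-t ^ (-α)) * t ^ (-α) = 1 * (t ^ (-(α + 1)) * t * Real.exp (-t ^ (-α))) := by
        rw [this]; ring
    _ ≤ α * (t ^ (-(α + 1)) * t * Real.exp (-t ^ (-α))) := by gcongr
    _ = _ := by ring

/-! ### Scalar inequalities. -/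

theorem mul_abs_log_mul_exp_neg_le {y : ℝ} (hy : 0 < y) : y * |Real.log y| * Real.exp (-y) ≤ 1 := by
  rcases le_total y 1 with h | h
  · have h1 := (Real.abs_log_mul_self_lt y hy h).le
    rw [abs_mul, abs_of_pos hy, mul_comm] at h1
    have h2 : Real.exp (-y) ≤ 1 := Real.exp_le_one_iff.2 (by linarith)
    exact mul_le_one₀ h1 (Real.exp_pos _).le h2
  · rw [abs_of_nonneg (Real.log_nonneg h), Real.exp_neg, ← div_eq_mul_inv,
      div_le_one (Real.exp_pos _)]
    have h1 := Real.log_le_sub_one_of_pos hy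
    -- At `y` itself the quadratic bound is too weak against `y (y - 1)` for large `y`. At `y / 2`,
    -- squared, it gives a quartic that suffices.
    have h2 := Real.quadratic_le_exp_of_nonneg (x := y / 2) (by linarith)
    have h3 : Real.exp y = Real.exp (y / 2) * Real.exp (y / 2) := by
      rw [← Real.exp_add]; ring_nf
    have h4 : (1 + y / 2 + (y / 2) ^ 2 / 2) * (1 + y / 2 + (y / 2) ^ 2 / 2) ≤ Real.exp y := by
      rw [h3]; gcongr
    have h5 : y * Real.log y ≤ y * (y - 1) := by gcongr
    nlinarith [mul_nonneg hy.le (sq_nonneg (y - 2)), sq_nonneg (y ^ 2)]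

/-- Mean value inequality in the exponent `s`: with `y = x^s`, the derivative of `exp (-x^s)` has
absolute value `y |log y| e^(-y) / s`, at most `1` as `s ≥ 1`. -/
theorem abs_exp_neg_sub_exp_neg_rpow_le {x b : ℝ} (hx : 0 < x) (hb : 1 ≤ b) :
    |Real.exp (-x) - Real.exp (-x ^ b)| ≤ b - 1 := by
  have hd : ∀ s ∈ Icc 1 b, HasDerivWithinAt (fun s => Real.exp (-x ^ s))
      (Real.exp (-x ^ s) * -(x ^ s * Real.log x)) (Icc 1 b) s := by
    intro s _
    have := ((Real.hasStrictDerivAt_const_rpow hx s).hasDerivAt.neg.exp)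
    exact this.hasDerivWithinAt
  have hbd : ∀ s ∈ Icc 1 b, ‖Real.exp (-x ^ s) * -(x ^ s * Real.log x)‖ ≤ 1 := by
    intro s hs
    have h0 : 0 < x ^ s := Real.rpow_pos_of_pos hx s
    have h1 := mul_abs_log_mul_exp_neg_le h0
    rw [Real.log_rpow hx, abs_mul, abs_of_nonneg (by linarith [hs.1] : (0 : ℝ) ≤ s)] at h1
    rw [Real.norm_eq_abs, abs_mul, abs_neg, abs_mul, abs_of_pos h0, Real.abs_exp]
    refine le_trans ?_ h1
    rw [mul_comm]
    gcongr
    nlinarith [abs_nonneg (Real.log x), hs.1]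
  have := (convex_Icc 1 b).norm_image_sub_le_of_norm_hasDerivWithin_le hd hbd
    (right_mem_Icc.2 hb) (left_mem_Icc.2 hb)
  simp only [Real.rpow_one, one_mul, Real.norm_eq_abs] at this
  rwa [abs_sub_comm 1 b, abs_of_nonneg (by linarith : 0 ≤ b - 1)] at this

/-- Factor out the larger of `x` and `x^c`: the difference is that number times `1 - e^(-u)` with `u
= (1 - c) |log x|`, and `1 - e^(-u) ≤ u`. The larger one is `x` when `x ≥ 1`, and `x^c ≤ 1`
otherwise. -/
theorem abs_sub_rpow_le {x c : ℝ} (hx : 0 < x) (hc0 : 0 ≤ c) (hc : c ≤ 1) :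
    |x - x ^ c| ≤ (1 - c) * (max 1 x * |Real.log x|) := by
  have hl : x = Real.exp (Real.log x) := (Real.exp_log hx).symm
  have hlc : x ^ c = Real.exp (c * Real.log x) := by
    rw [Real.rpow_def_of_pos hx, mul_comm]
  rcases le_total 1 x with h | h
  · have h0 := Real.log_nonneg h
    have h1 : x ^ c ≤ x := by
      simpa using Real.rpow_le_rpow_of_exponent_le h hc
    rw [abs_of_nonneg (by linarith), max_eq_right h, abs_of_nonneg h0]
    have h2 := Real.add_one_le_exp (-((1 - c) * Real.log x))
    have h3 : x ^ c = x * Real.exp (-((1 - c) * Real.log x)) := by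
      rw [hlc]
      nth_rewrite 2 [hl]
      rw [← Real.exp_add]; ring_nf
    nlinarith
  · have h0 := Real.log_nonpos hx.le h
    have h1 : x ≤ x ^ c := by
      simpa using Real.rpow_le_rpow_of_exponent_ge hx h hc
    have h1' : x ^ c ≤ 1 := Real.rpow_le_one hx.le h hc0
    rw [abs_of_nonpos (by linarith), max_eq_left h, abs_of_nonpos h0]
    have h2 := Real.add_one_le_exp ((1 - c) * Real.log x)
    have h3 : x = x ^ c * Real.exp ((1 - c) * Real.log x) := by
      rw [hlc, ← Real.exp_add]
      nth_rewrite 1 [hl]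
      ring_nf
    have h4 : 0 ≤ (1 - c) * -Real.log x := mul_nonneg (by linarith) (by linarith)
    have h5 : 0 < x ^ c := Real.rpow_pos_of_pos hx _
    nlinarith

theorem abs_exp_neg_sub_exp_neg_le {m x y : ℝ} (hx : m ≤ x) (hy : m ≤ y) :
    |Real.exp (-x) - Real.exp (-y)| ≤ Real.exp (-m) * |x - y| := by
  wlog h : x ≤ y generalizing x y
  · rw [abs_sub_comm, abs_sub_comm x]
    exact this hy hx (le_of_not_ge h)
  have h1 : Real.exp (-y) ≤ Real.exp (-x) := Real.exp_le_exp.2 (by linarith)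
  rw [abs_of_nonneg (by linarith), abs_sub_comm, abs_of_nonneg (by linarith)]
  have h2 : Real.exp (-x) ≤ Real.exp (-m) := Real.exp_le_exp.2 (by linarith)
  have h3 : Real.exp (-y) = Real.exp (-x) * Real.exp (-(y - x)) := by
    rw [← Real.exp_add]; ring_nf
  have h4 := Real.add_one_le_exp (-(y - x))
  have h5 : Real.exp (-x) * (y - x) ≤ Real.exp (-m) * (y - x) := by
    gcongr
  nlinarith [Real.exp_pos (-x)]

theorem mul_exp_neg_le_one (m : ℝ) : m * Real.exp (-m) ≤ 1 := by
  rw [Real.exp_neg, ← div_eq_mul_inv, div_le_one (Real.exp_pos _)]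
  linarith [Real.add_one_le_exp m]

/-! ### The exponent measure, its tail and its coordinate marginals. -/

variable {d : ℕ} {N : Seminorm ℝ (Fin d → ℝ)}

instance : SFinite radialMeasure := by unfold radialMeasure; infer_instance

theorem measurable_polarMap (α : ℝ) : Measurable (polarMap N α) := by
  unfold polarMap
  refine measurable_pi_lambda _ fun j => ?_
  have : Measurable fun p : ℝ × posSphere N => (p.2 : Fin d → ℝ) j :=
    (measurable_pi_apply j).comp (measurable_subtype_coe.comp measurable_snd)
  fun_prop

theorem measurable_coord (j : Fin d) : Measurable fun u : posSphere N => (u : Fin d → ℝ) j :=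
  (measurable_pi_apply j).comp measurable_subtype_coe

theorem lintegral_radialMeasure {g : ℝ → ℝ≥0∞} (hg : Measurable g) :
    ∫⁻ r, g r ∂radialMeasure = ∫⁻ r in Ioi (0 : ℝ), ENNReal.ofReal (1 / r ^ 2) * g r :=
  lintegral_withDensity_eq_lintegral_mul _ (by fun_prop) hg

theorem ae_radialMeasure_pos : ∀ᵐ r ∂radialMeasure, 0 < r :=
  (withDensity_absolutelyContinuous _ _).ae_le (ae_restrict_mem measurableSet_Ioi)

theorem radialMeasure_Ioi {a : ℝ} (ha : 0 < a) :
    radialMeasure (Ioi a) = ENNReal.ofReal a⁻¹ := by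
  rw [radialMeasure, withDensity_apply _ measurableSet_Ioi,
    Measure.restrict_restrict measurableSet_Ioi, Ioi_inter_Ioi, max_eq_left ha.le]
  have h1 : ∀ t ∈ Ioi a, ENNReal.ofReal (1 / t ^ 2) = ENNReal.ofReal (t ^ (-2 : ℝ)) := by
    intro t ht
    rw [Real.rpow_neg (ha.trans ht).le]
    norm_num
  rw [setLIntegral_congr_fun measurableSet_Ioi h1, ← ofReal_integral_eq_lintegral_ofReal
    (integrableOn_Ioi_rpow_of_lt (by norm_num) ha), integral_Ioi_rpow_of_lt (by norm_num) ha]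
  · congr 1
    norm_num
    rw [Real.rpow_neg_one]
  · filter_upwards [ae_restrict_mem measurableSet_Ioi] with t ht
    exact Real.rpow_nonneg (ha.trans ht).le _

/-- The mass that the radial measure gives to `r` with `1 < r * a j` for some `j`. -/
theorem radialMeasure_exists_one_lt_mul {ι : Type*} [Finite ι] {a : ι → ℝ} (ha : ∀ j, 0 ≤ a j) :
    radialMeasure {r | 0 < r ∧ ∃ j, 1 < r * a j} = ⨆ j, ENNReal.ofReal (a j) := by
  rcases isEmpty_or_nonempty ι with h | h
  · simp
  obtain ⟨j₀, hj₀⟩ := Finite.exists_max a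
  have h1 : ⨆ j, ENNReal.ofReal (a j) = ENNReal.ofReal (a j₀) :=
    le_antisymm (iSup_le fun j => ENNReal.ofReal_le_ofReal (hj₀ j))
      (le_iSup (fun j => ENNReal.ofReal (a j)) j₀)
  rw [h1]
  rcases (ha j₀).eq_or_lt with h0 | h0
  · have : {r | 0 < r ∧ ∃ j, 1 < r * a j} = ∅ := by
      ext r
      simp only [mem_ofPred_eq, mem_empty_iff_false, iff_false, not_and, not_exists, not_lt]
      intro hr j
      have := hj₀ j
      nlinarith
    simp [this, ← h0]
  · have : {r | 0 < r ∧ ∃ j, 1 < r * a j} = Ioi (a j₀)⁻¹ := by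
      ext r
      simp only [mem_ofPred_eq, mem_Ioi]
      constructor
      · rintro ⟨hr, j, hj⟩
        rw [inv_lt_iff_one_lt_mul₀ h0]
        have := mul_le_mul_of_nonneg_left (hj₀ j) hr.le
        linarith
      · intro hr
        exact ⟨(inv_pos.2 h0).trans hr, j₀, (inv_lt_iff_one_lt_mul₀ h0).1 hr⟩
    rw [this, radialMeasure_Ioi (inv_pos.2 h0), inv_inv]

/-- The tail `∫ max_j u^j / (z^j)^α dν(u)` of the exponent measure. -/
noncomputable def tail (α : ℝ) (ν : Measure (posSphere N)) (z : Fin d → ℝ) : ℝ≥0∞ :=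
  ∫⁻ u, ⨆ j, ENNReal.ofReal ((u : Fin d → ℝ) j * z j ^ (-α)) ∂ν

/-- For fixed `u`, the point `(r u)^(1/α)` leaves `[0, z]` exactly when `r u^j (z^j)^(-α) > 1` for
some `j`. The radial mass of such `r` is the maximum over `j`, which is then integrated in `u`. -/
theorem exponentMeasure_compl_Icc {α : ℝ} (hα : 0 < α) (ν : Measure (posSphere N)) [SFinite ν]
    {z : Fin d → ℝ} (hz : z ∈ posOrthant d) :
    exponentMeasure α ν (Icc 0 z)ᶜ = tail α ν z := by
  have hmeas : MeasurableSet ((Icc 0 z)ᶜ : Set (Fin d → ℝ)) := measurableSet_Icc.compl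
  rw [exponentMeasure, Measure.map_apply (measurable_polarMap α) hmeas,
    Measure.prod_apply_symm (measurable_polarMap α hmeas), tail]
  refine lintegral_congr fun u => ?_
  rw [← radialMeasure_exists_one_lt_mul fun j =>
    mul_nonneg (u.2.1 j) (Real.rpow_nonneg (hz j).le _)]
  refine measure_congr ?_
  filter_upwards [ae_radialMeasure_pos] with r hr
  refine propext ?_
  change ¬ (0 ≤ polarMap N α (r, u) ∧ polarMap N α (r, u) ≤ z) ↔
    0 < r ∧ ∃ j, 1 < r * ((u : Fin d → ℝ) j * z j ^ (-α))
  have h0 : 0 ≤ polarMap N α (r, u) := fun j =>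
    Real.rpow_nonneg (mul_nonneg hr.le (u.2.1 j)) _
  have h1 : ∀ j, z j < polarMap N α (r, u) j ↔ 1 < r * ((u : Fin d → ℝ) j * z j ^ (-α)) := by
    intro j
    have hzα : 0 < z j ^ α := Real.rpow_pos_of_pos (hz j) _
    rw [polarMap, one_div, Real.lt_rpow_inv_iff_of_pos (hz j).le
      (mul_nonneg hr.le (u.2.1 j)) hα, Real.rpow_neg (hz j).le, ← mul_assoc, ← div_eq_mul_inv,
      one_lt_div hzα]
  simp only [h0, true_and, hr, Pi.le_def, not_forall, not_le, h1]

theorem lintegral_coord {ν : Measure (posSphere N)} (hν : MomentConstraints ν) (j : Fin d) :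
    ∫⁻ u, ENNReal.ofReal ((u : Fin d → ℝ) j) ∂ν = 1 := by
  rw [← ofReal_integral_eq_lintegral_ofReal (integrable_of_integral_eq_one (hν j))
    (Filter.Eventually.of_forall fun u => u.2.1 j), hν j, ENNReal.ofReal_one]

theorem tail_add (α : ℝ) (ν κ : Measure (posSphere N)) (z : Fin d → ℝ) :
    tail α (ν + κ) z = tail α ν z + tail α κ z := lintegral_add_measure _ _ _

/-- Keep only the `j`-th term of the supremum; the moment constraint evaluates its integral. -/
theorem le_tail {ν : Measure (posSphere N)} (hν : MomentConstraints ν) {α : ℝ} {z : Fin d → ℝ}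
    (j : Fin d) : ENNReal.ofReal (z j ^ (-α)) ≤ tail α ν z := by
  calc ENNReal.ofReal (z j ^ (-α))
      = ∫⁻ u, ENNReal.ofReal ((u : Fin d → ℝ) j) * ENNReal.ofReal (z j ^ (-α)) ∂ν := by
        rw [lintegral_mul_const _ (measurable_coord j).ennreal_ofReal, lintegral_coord hν, one_mul]
    _ ≤ tail α ν z := by
        refine lintegral_mono fun u => ?_
        rw [← ENNReal.ofReal_mul (u.2.1 j)]
        exact le_iSup (fun j => ENNReal.ofReal ((u : Fin d → ℝ) j * z j ^ (-α))) j

theorem tail_le (hN : ∀ x ∈ posSphere N, ∀ j, x j ≤ 1) (ν : Measure (posSphere N)) {α c : ℝ}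
    {z : Fin d → ℝ} (hc : ∀ j, z j ^ (-α) ≤ c) : tail α ν z ≤ ENNReal.ofReal c * ν univ := by
  rw [← lintegral_const]
  refine lintegral_mono fun u => iSup_le fun j => ?_
  refine (ENNReal.ofReal_le_ofReal (mul_le_mul_of_nonneg_left (hc j) (u.2.1 j))).trans ?_
  rcases le_total 0 c with h | h
  · exact ENNReal.ofReal_le_ofReal (mul_le_of_le_one_left h (hN u u.2 j))
  · rw [ENNReal.ofReal_of_nonpos (mul_nonpos_of_nonneg_of_nonpos (u.2.1 j) h)]
    exact zero_le

theorem tail_ne_top (hN : ∀ x ∈ posSphere N, ∀ j, x j ≤ 1) (ν : Measure (posSphere N))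
    [IsFiniteMeasure ν] (α : ℝ) (z : Fin d → ℝ) : tail α ν z ≠ ∞ := by
  obtain ⟨c, hc⟩ := Set.Finite.bddAbove (Set.finite_range fun j => z j ^ (-α))
  exact ne_top_of_le_ne_top (ENNReal.mul_ne_top ENNReal.ofReal_ne_top (measure_ne_top ν _))
    (tail_le hN ν fun j => hc ⟨j, rfl⟩)

/-- The supremum is at most its `j`-th term plus a bound `c` for the others. Letting `c → 0`
isolates the `j`-th marginal. -/
theorem tail_le_of_coord (hN : ∀ x ∈ posSphere N, ∀ j, x j ≤ 1) {ν : Measure (posSphere N)}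
    (hν : MomentConstraints ν) {α c : ℝ} {z : Fin d → ℝ} (hc0 : 0 ≤ c) (j : Fin d)
    (hc : ∀ k, k ≠ j → z k ^ (-α) ≤ c) :
    tail α ν z ≤ ENNReal.ofReal (z j ^ (-α)) + ENNReal.ofReal c * ν univ := by
  calc tail α ν z ≤ ∫⁻ u, (ENNReal.ofReal ((u : Fin d → ℝ) j) * ENNReal.ofReal (z j ^ (-α))
        + ENNReal.ofReal c) ∂ν := by
        refine lintegral_mono fun u => iSup_le fun k => ?_
        by_cases hk : k = j
        · subst hk
          rw [ENNReal.ofReal_mul (u.2.1 k)]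
          exact le_self_add
        · refine le_trans ?_ le_add_self
          refine ENNReal.ofReal_le_ofReal ?_
          calc (u : Fin d → ℝ) k * z k ^ (-α) ≤ (u : Fin d → ℝ) k * c :=
                mul_le_mul_of_nonneg_left (hc k hk) (u.2.1 k)
            _ ≤ c := mul_le_of_le_one_left hc0 (hN u u.2 k)
    _ = _ := by
        rw [lintegral_add_right _ measurable_const,
          lintegral_mul_const _ (measurable_coord j).ennreal_ofReal, lintegral_coord hν, one_mul,
          lintegral_const]

/-- The coordinate marginals of the exponent measure. -/
theorem lintegral_exponentMeasure_coord {α : ℝ} (hα : 0 < α) {ν : Measure (posSphere N)} [SFinite ν]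
    (hν : MomentConstraints ν) (j : Fin d) {G : ℝ → ℝ≥0∞} (hG : Measurable G) (hG0 : G 0 = 0) :
    ∫⁻ y, G (y j) ∂(exponentMeasure α ν)
      = ∫⁻ t in Ioi (0 : ℝ), ENNReal.ofReal (α * t ^ (-(α + 1))) * G t := by
  have hm : Measurable fun y : Fin d → ℝ => G (y j) := hG.comp (measurable_pi_apply j)
  rw [exponentMeasure, lintegral_map hm (measurable_polarMap α),
    lintegral_prod_symm (fun a => G (polarMap N α a j))
      (hm.comp (measurable_polarMap α)).aemeasurable]
  set I := ∫⁻ t in Ioi (0 : ℝ), ENNReal.ofReal (α * t ^ (-(α + 1))) * G t with hI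
  calc _ = ∫⁻ u, ENNReal.ofReal ((u : Fin d → ℝ) j) * I ∂ν := by
        refine lintegral_congr fun u => ?_
        have hm' : Measurable fun r : ℝ => G ((r * (u : Fin d → ℝ) j) ^ (1 / α)) :=
          hG.comp (by fun_prop)
        change ∫⁻ r, G ((r * (u : Fin d → ℝ) j) ^ (1 / α)) ∂radialMeasure = _
        -- Directions with `u^j = 0` contribute nothing since `G 0 = 0`. For the others, substitute
        -- `r = t^α / u^j`.
        rcases (u.2.1 j).eq_or_lt with h0 | h0
        · have : (0 : ℝ) ^ (1 / α) = 0 := Real.zero_rpow (by positivity)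
          simp [← h0, hG0, hα.ne']
        · rw [lintegral_radialMeasure hm', ← lintegral_comp_mul_rpow_Ioi (inv_pos.2 h0) hα.ne',
            hI, ← lintegral_const_mul _ (by fun_prop)]
          refine setLIntegral_congr_fun measurableSet_Ioi fun t ht => ?_
          have ht : 0 < t := ht
          set c := (u : Fin d → ℝ) j
          have hta : (c⁻¹ * t ^ α * c) ^ (1 / α) = t := by
            rw [mul_right_comm, inv_mul_cancel₀ h0.ne', one_mul, ← Real.rpow_mul ht.le,
              mul_one_div_cancel hα.ne', Real.rpow_one]
          rw [hta, ← mul_assoc, ← ENNReal.ofReal_mul (by positivity),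
            ← mul_assoc (ENNReal.ofReal c), ← ENNReal.ofReal_mul h0.le, abs_of_pos hα]
          congr 2
          have h1 : t ^ (α - 1) = t ^ α * t⁻¹ := by
            rw [Real.rpow_sub_one ht.ne', div_eq_mul_inv]
          have h2 : t ^ (-(α + 1)) = (t ^ α)⁻¹ * t⁻¹ := by
            rw [Real.rpow_neg ht.le, Real.rpow_add_one ht.ne', mul_inv]
          have h3 : 0 < t ^ α := Real.rpow_pos_of_pos ht _
          rw [h1, h2]
          field_simp
    _ = I := by
        rw [lintegral_mul_const _ (measurable_coord j).ennreal_ofReal, lintegral_coord hν, one_mul]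

/-! ### Maxima of Poisson processes. -/

/-- Probability measures on `ℝ^d` are determined by their distribution functions. -/
theorem measure_ext_of_Iic {L L' : Measure (Fin d → ℝ)} [IsProbabilityMeasure L]
    [IsProbabilityMeasure L'] (h : ∀ z, L (Iic z) = L' (Iic z)) : L = L' := by
  have hspan : IsCountablySpanning (range (Iic : ℝ → Set ℝ)) := by
    refine ⟨fun n : ℕ => Iic (n : ℝ), fun n => ⟨_, rfl⟩, ?_⟩
    exact iUnion_eq_univ_iff.2 fun x => exists_nat_ge x
  have hgen : ∀ _ : Fin d, MeasurableSpace.generateFrom (range (Iic : ℝ → Set ℝ)) =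
      (inferInstance : MeasurableSpace ℝ) := fun _ => by
    rw [← borel_eq_generateFrom_Iic, BorelSpace.measurable_eq (α := ℝ)]
  refine ext_of_generate_finite _ (generateFrom_eq_pi hgen fun _ => hspan).symm
    (IsPiSystem.pi fun _ => by simpa using isPiSystem_image_Iic (univ : Set ℝ)) ?_ (by simp)
  rintro s ⟨t, ht, rfl⟩
  choose z hz using fun j => ht j (mem_univ j)
  have : univ.pi t = Iic z := by
    rw [← pi_univ_Iic]
    exact congrArg _ (funext fun j => (hz j).symm)
  rw [this, h]

/-- The (unnormalized) law of the maximum of `x` and `n` independent points of intensity `θ`. -/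
noncomputable def supPow (x : Fin d → ℝ) (θ : Measure (Fin d → ℝ)) : ℕ → Measure (Fin d → ℝ)
  | 0 => Measure.dirac x
  | n + 1 => ((supPow x θ n).prod θ).map fun p => p.1 ⊔ p.2

theorem isFiniteMeasure_supPow (x : Fin d → ℝ) (θ : Measure (Fin d → ℝ)) [IsFiniteMeasure θ]
    (n : ℕ) : IsFiniteMeasure (supPow x θ n) := by
  induction n with
  | zero => unfold supPow; infer_instance
  | succ n ih => unfold supPow; infer_instance

theorem measurable_sup_pi :
    Measurable fun p : (Fin d → ℝ) × (Fin d → ℝ) => p.1 ⊔ p.2 :=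
  measurable_pi_lambda _ fun j => ((measurable_pi_apply j).comp measurable_fst).sup
    ((measurable_pi_apply j).comp measurable_snd)

theorem supPow_apply (x : Fin d → ℝ) (θ : Measure (Fin d → ℝ)) [IsFiniteMeasure θ]
    {s : Set (Fin d → ℝ)} (hs : MeasurableSet s) (h : ∀ a b, a ⊔ b ∈ s ↔ a ∈ s ∧ b ∈ s) (n : ℕ) :
    supPow x θ n s = Measure.dirac x s * θ s ^ n := by
  induction n with
  | zero => simp [supPow]
  | succ n ih =>
    have := isFiniteMeasure_supPow x θ n
    have hpre : (fun p : (Fin d → ℝ) × (Fin d → ℝ) => p.1 ⊔ p.2) ⁻¹' s = s ×ˢ s := by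
      ext p
      exact h p.1 p.2
    rw [supPow, Measure.map_apply measurable_sup_pi hs, hpre, Measure.prod_prod, ih, pow_succ,
      mul_assoc]

/-- The law of the maximum of `x` and of a Poisson process with finite intensity `θ`. -/
noncomputable def poissonMax (x : Fin d → ℝ) (θ : Measure (Fin d → ℝ)) : Measure (Fin d → ℝ) :=
  Measure.sum fun n : ℕ =>
    ENNReal.ofReal (Real.exp (-θ.real univ) / n.factorial) • supPow x θ n

/-- The condition on `s` says that a maximum lies in `s` iff each point does, so `n` points
contribute `θ(s)^n / n!` and the exponential series sums. It is used for `s = univ` (total mass) and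
`s = Iic z` (c.d.f.). -/
theorem poissonMax_apply (x : Fin d → ℝ) (θ : Measure (Fin d → ℝ)) [IsFiniteMeasure θ]
    {s : Set (Fin d → ℝ)} (hs : MeasurableSet s) (h : ∀ a b, a ⊔ b ∈ s ↔ a ∈ s ∧ b ∈ s) :
    poissonMax x θ s = Measure.dirac x s * ENNReal.ofReal (Real.exp (-θ.real sᶜ)) := by
  have h1 : ∀ n : ℕ, ENNReal.ofReal (Real.exp (-θ.real univ) / n.factorial) * θ s ^ n
      = ENNReal.ofReal (Real.exp (-θ.real univ) * (θ.real s ^ n / n.factorial)) := by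
    intro n
    rw [← ofReal_measureReal (μ := θ) (s := s), ← ENNReal.ofReal_pow measureReal_nonneg,
      ← ENNReal.ofReal_mul (by positivity)]
    congr 1
    ring
  have h2 : HasSum (fun n : ℕ => Real.exp (-θ.real univ) * (θ.real s ^ n / n.factorial))
      (Real.exp (-θ.real sᶜ)) := by
    have := (NormedSpace.expSeries_div_hasSum_exp (θ.real s)).mul_left (Real.exp (-θ.real univ))
    rw [← Real.exp_eq_exp_ℝ, ← Real.exp_add] at this
    rwa [show -θ.real univ + θ.real s = -θ.real sᶜ by
      rw [measureReal_compl hs]; ring] at this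
  rw [poissonMax, Measure.sum_apply _ hs]
  simp only [Measure.smul_apply, smul_eq_mul, supPow_apply x θ hs h, mul_left_comm _
    (Measure.dirac x s), h1]
  rw [ENNReal.tsum_mul_left, ← h2.tsum_eq,
    ENNReal.ofReal_tsum_of_nonneg (fun n => by positivity) h2.summable]

theorem isProbabilityMeasure_poissonMax (x : Fin d → ℝ) (θ : Measure (Fin d → ℝ))
    [IsFiniteMeasure θ] : IsProbabilityMeasure (poissonMax x θ) :=
  ⟨by rw [poissonMax_apply x θ MeasurableSet.univ (by simp)]; simp⟩

theorem exponentMeasure_compl_Iic {α : ℝ} (hα : 0 < α) (ν : Measure (posSphere N)) [SFinite ν]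
    {z : Fin d → ℝ} (hz : z ∈ posOrthant d) :
    exponentMeasure α ν (Iic z)ᶜ = tail α ν z := by
  rw [← exponentMeasure_compl_Icc hα ν hz]
  have h0 : ∀ᵐ y ∂(exponentMeasure α ν), 0 ≤ y := by
    rw [exponentMeasure, ae_map_iff (measurable_polarMap α).aemeasurable measurableSet_Ici]
    have := (Measure.quasiMeasurePreserving_fst (ν := ν)).ae ae_radialMeasure_pos
    filter_upwards [this] with p hp
    exact fun j => Real.rpow_nonneg (mul_nonneg hp.le (p.2.2.1 j)) _
  refine measure_congr ?_
  filter_upwards [h0] with y hy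
  refine propext ?_
  change ¬ y ≤ z ↔ ¬ (0 ≤ y ∧ y ≤ z)
  simp [hy]

/-- The law of the maximum of `δ` and of a Poisson process with intensity the exponent measure. -/
theorem exists_truncated_maxStable (hN : ∀ x ∈ posSphere N, ∀ j, x j ≤ 1) {α : ℝ} (hα : 0 < α)
    (κ : Measure (posSphere N)) [IsFiniteMeasure κ] {δ : Fin d → ℝ} (hδ : δ ∈ posOrthant d) :
    ∃ Q : Measure (Fin d → ℝ), IsProbabilityMeasure Q ∧
      (∀ z, δ ≤ z → Q (Iic z) = ENNReal.ofReal (Real.exp (-(tail α κ z).toReal))) ∧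
      ∀ z, ¬ δ ≤ z → Q (Iic z) = 0 := by
  -- Points below `δ` do not affect a maximum with `δ`. Discarding them makes the intensity finite,
  -- with mass `tail α κ δ`.
  set θ := (exponentMeasure α κ).restrict (Iic δ)ᶜ
  have hfin : IsFiniteMeasure θ := by
    refine ⟨?_⟩
    rw [Measure.restrict_apply_univ, exponentMeasure_compl_Iic hα κ hδ]
    exact (tail_ne_top hN κ α δ).lt_top
  have hs : ∀ z a b : Fin d → ℝ, a ⊔ b ∈ Iic z ↔ a ∈ Iic z ∧ b ∈ Iic z := fun z a b =>
    (sup_le_iff : a ⊔ b ≤ z ↔ _)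
  refine ⟨poissonMax δ θ, isProbabilityMeasure_poissonMax δ θ, fun z hz => ?_, fun z hz => ?_⟩
  · have hz0 : z ∈ posOrthant d := fun j => (hδ j).trans_le (hz j)
    rw [poissonMax_apply δ θ measurableSet_Iic (hs z), Measure.dirac_apply' _ measurableSet_Iic,
      indicator_of_mem (show δ ∈ Iic z from hz), Pi.one_apply, one_mul, measureReal_def,
      Measure.restrict_apply measurableSet_Iic.compl,
      inter_eq_left.2 (compl_subset_compl.2 (Iic_subset_Iic.2 hz)),
      exponentMeasure_compl_Iic hα κ hz0]
  · rw [poissonMax_apply δ θ measurableSet_Iic (hs z), Measure.dirac_apply' _ measurableSet_Iic,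
      indicator_of_notMem (show δ ∉ Iic z from hz), zero_mul]

/-- The index enters the tail only through `(z^j)^(-β)`, so changing it amounts to taking a power of
`z`. This is what makes coordinatewise powers move the index. -/
theorem tail_rpow {α β : ℝ} (hα : 0 < α) (ν : Measure (posSphere N)) {z : Fin d → ℝ}
    (hz : z ∈ posOrthant d) : tail β ν z = tail α ν fun j => z j ^ (β / α) := by
  unfold tail
  refine lintegral_congr fun u => ?_
  refine iSup_congr fun j => ?_
  rw [← Real.rpow_mul (hz j).le]
  congr 3
  field_simp

/-! ### Max-stable laws: marginals and powers. -/

section law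

variable {α : ℝ} {ν : Measure (posSphere N)}

/-- Reduces statements about random vectors to statements about their laws on `ℝ^d`, with `id` as
the vector. -/
theorem IsMaxStable.map {Ω : Type*} [MeasurableSpace Ω] {P : Measure Ω} {Z : Ω → Fin d → ℝ}
    (h : IsMaxStable α ν P Z) : IsMaxStable α ν (P.map Z) id := by
  refine ⟨aemeasurable_id, ?_, fun z hz => ?_⟩
  · have hm : MeasurableSet (posOrthant d) := by
      have : posOrthant d = ⋂ j, {x | 0 < x j} := by ext; simp [posOrthant]
      rw [this]
      exact MeasurableSet.iInter fun j => measurableSet_lt measurable_const (measurable_pi_apply j)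
    exact (ae_map_iff h.aemeasurable hm).2 h.pos
  · rw [← h.cdf z hz]
    exact map_measureReal_apply_of_aemeasurable h.aemeasurable measurableSet_Iic

variable {L : Measure (Fin d → ℝ)}

theorem IsMaxStable.apply_Iic [IsProbabilityMeasure L] (hL : IsMaxStable α ν L id) (hα : 0 < α) [SFinite ν]
    {z : Fin d → ℝ} (hz : z ∈ posOrthant d) :
    L (Iic z) = ENNReal.ofReal (Real.exp (-(tail α ν z).toReal)) := by
  rw [← exponentMeasure_compl_Icc hα ν hz]
  change _ = ENNReal.ofReal (Real.exp (-(exponentMeasure α ν).real (Icc 0 z)ᶜ))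
  rw [← hL.cdf z hz]
  exact (ofReal_measureReal (μ := L) (s := Iic z)).symm

theorem IsMaxStable.apply_eval_le_of_nonpos (hL : IsMaxStable α ν L id) {j : Fin d} {t : ℝ}
    (ht : t ≤ 0) : L {x | x j ≤ t} = 0 := by
  refine measure_mono_null (t := {x | ¬ id x ∈ posOrthant d}) (fun x hx hpos => ?_)
    (ae_iff.1 hL.pos)
  have h1 : 0 < x j := hpos j
  have h2 : x j ≤ t := hx
  linarith

/-- The marginals of a max-stable law are Fréchet. -/
theorem IsMaxStable.apply_eval_le (hN : ∀ x ∈ posSphere N, ∀ j, x j ≤ 1) (hα : 0 < α)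
    [IsFiniteMeasure ν] [IsProbabilityMeasure L] (hν : MomentConstraints ν)
    (hL : IsMaxStable α ν L id) (j : Fin d) (t : ℝ) :
    L {x | x j ≤ t} = frechet α (Iic t) := by
  rcases le_or_gt t 0 with ht | ht
  · rw [hL.apply_eval_le_of_nonpos ht, frechet_Iic_of_nonpos ht]
  rw [frechet_Iic hα ht]
  -- The marginal at `t` is the limit of the joint c.d.f. as all coordinates other than `j` tend to
  -- infinity.
  set z : ℕ → Fin d → ℝ := fun n => Function.update (fun _ => t + n) j t with hz
  have hzj : ∀ n, z n j = t := fun n => by simp [hz]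
  have hzk : ∀ n k, k ≠ j → z n k = t + n := fun n k hk => by simp [hz, hk]
  have hmono : Monotone fun n => Iic (z n) := by
    intro m n hmn
    refine Iic_subset_Iic.2 fun k => ?_
    by_cases hk : k = j
    · rw [hk, hzj, hzj]
    · rw [hzk _ _ hk, hzk _ _ hk]
      gcongr
  have hU : ⋃ n, Iic (z n) = {x | x j ≤ t} := by
    ext x
    simp only [mem_iUnion, mem_Iic, mem_ofPred_eq]
    constructor
    · rintro ⟨n, hn⟩
      simpa [hzj] using hn j
    · intro hx
      obtain ⟨c, hc⟩ := Set.Finite.bddAbove (Set.finite_range x)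
      obtain ⟨n, hn⟩ := exists_nat_ge c
      refine ⟨n, fun k => ?_⟩
      by_cases hk : k = j
      · rw [hk, hzj]; exact hx
      · rw [hzk _ _ hk]
        linarith [hc ⟨k, rfl⟩]
  have h1 := tendsto_measure_iUnion_atTop (μ := L) hmono
  rw [hU] at h1
  have hzpos : ∀ n, z n ∈ posOrthant d := by
    intro n k
    by_cases hk : k = j
    · rw [hk, hzj]; exact ht
    · rw [hzk _ _ hk]; positivity
  -- Squeeze between `le_tail` and `tail_le_of_coord`.
  have htail : Filter.Tendsto (fun n => (tail α ν (z n)).toReal) Filter.atTop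
      (nhds (t ^ (-α))) := by
    have hlim : Filter.Tendsto (fun n : ℕ => t ^ (-α) + (t + n) ^ (-α) * ν.real univ) Filter.atTop
        (nhds (t ^ (-α))) := by
      have h2 : Filter.Tendsto (fun n : ℕ => (t + n) ^ (-α)) Filter.atTop (nhds 0) :=
        (tendsto_rpow_neg_atTop hα).comp
          (Filter.tendsto_atTop_add_const_left _ t tendsto_natCast_atTop_atTop)
      simpa using (h2.mul_const (ν.real univ)).const_add (t ^ (-α))
    refine tendsto_of_tendsto_of_tendsto_of_le_of_le tendsto_const_nhds hlim (fun n => ?_)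
      (fun n => ?_)
    · have := le_tail hν (α := α) (z := z n) j
      rw [hzj] at this
      exact (ENNReal.ofReal_le_iff_le_toReal (tail_ne_top hN ν α _)).1 this
    · have h0 : 0 ≤ t ^ (-α) := Real.rpow_nonneg ht.le _
      have h3 : (0 : ℝ) ≤ (t + n) ^ (-α) := Real.rpow_nonneg (by positivity) _
      have := tail_le_of_coord hN hν (α := α) (z := z n) h3 j fun k hk => by rw [hzk _ _ hk]
      rw [hzj, ← ofReal_measureReal (μ := ν) (s := univ), ← ENNReal.ofReal_mul h3,
        ← ENNReal.ofReal_add h0 (mul_nonneg h3 measureReal_nonneg)] at this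
      exact ENNReal.toReal_le_of_le_ofReal (add_nonneg h0 (mul_nonneg h3 measureReal_nonneg)) this
  refine tendsto_nhds_unique h1 ?_
  simp only [Function.comp_def, hL.apply_Iic hα (hzpos _)]
  exact ENNReal.tendsto_ofReal ((Real.continuous_exp.tendsto _).comp htail.neg)

theorem IsMaxStable.map_eval (hN : ∀ x ∈ posSphere N, ∀ j, x j ≤ 1) (hα : 0 < α)
    [IsFiniteMeasure ν] [IsProbabilityMeasure L] (hν : MomentConstraints ν)
    (hL : IsMaxStable α ν L id) (j : Fin d) :
    L.map (fun x => x j) = frechet α := by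
  have := Measure.isProbabilityMeasure_map (μ := L) (measurable_pi_apply j).aemeasurable
  refine Measure.ext_of_Iic _ _ fun t => ?_
  rw [Measure.map_apply (measurable_pi_apply j) measurableSet_Iic,
    ← hL.apply_eval_le hN hα hν j t]
  rfl

/-- Coordinatewise powers of max-stable vectors. -/
theorem IsMaxStable.map_rpow (hα : 0 < α) [SFinite ν] (hL : IsMaxStable α ν L id) {β : ℝ}
    (hβ : 0 < β) :
    IsMaxStable β ν (L.map fun x j => x j ^ (α / β)) id := by
  have hm : Measurable fun (x : Fin d → ℝ) j => x j ^ (α / β) :=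
    measurable_pi_lambda _ fun j => (measurable_pi_apply j).pow_const _
  refine IsMaxStable.map ⟨hm.aemeasurable, ?_, fun z hz => ?_⟩
  · filter_upwards [hL.pos] with x hx
    exact fun j => Real.rpow_pos_of_pos (hx j) _
  · have hw : (fun j => z j ^ (β / α)) ∈ posOrthant d := fun j => Real.rpow_pos_of_pos (hz j) _
    rw [measureReal_def (exponentMeasure β ν), exponentMeasure_compl_Icc hβ ν hz, tail_rpow hα ν hz,
      ← exponentMeasure_compl_Icc hα ν hw]
    change _ = Real.exp (-(exponentMeasure α ν).real (Icc 0 _)ᶜ)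
    rw [← hL.cdf _ hw, measureReal_def]
    congr 1
    refine measure_congr ?_
    filter_upwards [hL.pos] with x hx
    refine propext ?_
    change (∀ j, x j ^ (α / β) ≤ z j) ↔ ∀ j, x j ≤ z j ^ (β / α)
    refine forall_congr' fun j => ?_
    have hx : 0 < x j := hx j
    rw [← inv_div α β, Real.le_rpow_inv_iff_of_pos hx.le (hz j).le (by positivity)]

end law

/-! ### Decomposition of the difference of two measures. -/

/-- The positive and negative parts of `ν₁ - ν₂`. -/
theorem exists_add_eq_add_tvDist {S : Type*} [MeasurableSpace S] (ν₁ ν₂ : Measure S)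
    [IsFiniteMeasure ν₁] [IsFiniteMeasure ν₂] :
    ∃ a b : Measure S, IsFiniteMeasure a ∧ IsFiniteMeasure b ∧ ν₁ + b = ν₂ + a ∧
      a univ + b univ = tvDist ν₁ ν₂ := by
  set μ := ν₁ + ν₂ with hμ
  set f := ν₁.rnDeriv μ with hf
  set g := ν₂.rnDeriv μ with hg
  have hfm : Measurable f := Measure.measurable_rnDeriv _ _
  have hgm : Measurable g := Measure.measurable_rnDeriv _ _
  have h1 : μ.withDensity f = ν₁ := Measure.withDensity_rnDeriv_eq _ _
    (Measure.absolutelyContinuous_of_le (Measure.le_add_right le_rfl))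
  have h2 : μ.withDensity g = ν₂ := Measure.withDensity_rnDeriv_eq _ _
    (Measure.absolutelyContinuous_of_le (Measure.le_add_left le_rfl))
  have ha : IsFiniteMeasure (μ.withDensity (f - g)) :=
    isFiniteMeasure_of_le ν₁ (h1 ▸ withDensity_mono (Filter.Eventually.of_forall fun x =>
      tsub_le_self))
  have hb : IsFiniteMeasure (μ.withDensity (g - f)) :=
    isFiniteMeasure_of_le ν₂ (h2 ▸ withDensity_mono (Filter.Eventually.of_forall fun x =>
      tsub_le_self))
  -- Subtraction in `ℝ≥0∞` is truncated, so these densities are the positive parts of `f - g` and `g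
  -- - f`, and `f + (g - f) = max f g` is symmetric.
  refine ⟨μ.withDensity (f - g), μ.withDensity (g - f), ha, hb, ?_, ?_⟩
  · calc ν₁ + μ.withDensity (g - f) = μ.withDensity f + μ.withDensity (g - f) := by rw [h1]
      _ = μ.withDensity g + μ.withDensity (f - g) := ?_
      _ = ν₂ + μ.withDensity (f - g) := by rw [h2]
    rw [← withDensity_add_left hfm, ← withDensity_add_left hgm]
    congr 1
    ext x
    simp only [Pi.add_apply, Pi.sub_apply, add_tsub_eq_max, max_comm]
  · rw [withDensity_apply _ MeasurableSet.univ, withDensity_apply _ MeasurableSet.univ,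
      Measure.restrict_univ, ← lintegral_add_left (hfm.sub hgm), tvDist]
    refine lintegral_congr_ae ?_
    filter_upwards [Measure.rnDeriv_lt_top ν₁ μ, Measure.rnDeriv_lt_top ν₂ μ] with x hx hy
    change f x - g x + (g x - f x) = ENNReal.ofReal |(f x).toReal - (g x).toReal|
    rcases le_total (f x) (g x) with h | h
    · rw [tsub_eq_zero_of_le h, zero_add, abs_sub_comm, abs_of_nonneg
        (sub_nonneg.2 (ENNReal.toReal_mono hy.ne h)), ENNReal.ofReal_sub _ ENNReal.toReal_nonneg,
        ENNReal.ofReal_toReal hx.ne, ENNReal.ofReal_toReal hy.ne]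
    · rw [tsub_eq_zero_of_le h, add_zero, abs_of_nonneg
        (sub_nonneg.2 (ENNReal.toReal_mono hx.ne h)), ENNReal.ofReal_sub _ ENNReal.toReal_nonneg,
        ENNReal.ofReal_toReal hx.ne, ENNReal.ofReal_toReal hy.ne]

/-! ### Kolmogorov distance -/

/-- A point below `z` but not below `w` has some coordinate in `(w j, z j]`; apply the union bound.
-/
theorem measureReal_Iic_sub_le (L : Measure (Fin d → ℝ)) [IsProbabilityMeasure L]
    (z w : Fin d → ℝ) : L.real (Iic z) - L.real (Iic w)
      ≤ ∑ j, |L.real {x | x j ≤ z j} - L.real {x | x j ≤ w j}| := by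
  have hsub : Iic z ⊆ Iic w ∪ ⋃ j, ({x | x j ≤ z j} \ {x | x j ≤ w j}) := by
    intro x hx
    by_cases h : x ≤ w
    · exact Or.inl h
    · obtain ⟨j, hj⟩ := not_forall.1 h
      exact Or.inr (mem_iUnion.2 ⟨j, (show x ≤ z from hx) j, hj⟩)
  have h1 : L.real (Iic z) ≤ L.real (Iic w)
      + ∑ j, L.real ({x | x j ≤ z j} \ {x | x j ≤ w j}) :=
    (measureReal_mono hsub).trans ((measureReal_union_le _ _).trans
      (add_le_add_right (measureReal_iUnion_fintype_le _) _))
  have h2 : ∀ j, L.real ({x | x j ≤ z j} \ {x | x j ≤ w j})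
      ≤ |L.real {x | x j ≤ z j} - L.real {x | x j ≤ w j}| := by
    intro j
    rcases le_total (z j) (w j) with h | h
    · have : ({x : Fin d → ℝ | x j ≤ z j} \ {x | x j ≤ w j}) = ∅ :=
        sdiff_eq_empty.2 fun x hx => le_trans (show x j ≤ z j from hx) h
      rw [this, measureReal_empty]
      exact abs_nonneg _
    · have hle : {x : Fin d → ℝ | x j ≤ w j} ⊆ {x | x j ≤ z j} := fun x hx =>
        le_trans (show x j ≤ w j from hx) h
      rw [measureReal_sdiff hle
        (measurableSet_le (measurable_pi_apply j) measurable_const)]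
      exact le_abs_self _
  have h3 := Finset.sum_le_sum fun j (_ : j ∈ Finset.univ) => h2 j
  linarith

theorem abs_measureReal_Iic_sub_le (L : Measure (Fin d → ℝ)) [IsProbabilityMeasure L]
    (z w : Fin d → ℝ) : |L.real (Iic z) - L.real (Iic w)|
      ≤ ∑ j, |L.real {x | x j ≤ z j} - L.real {x | x j ≤ w j}| := by
  refine abs_sub_le_iff.2 ⟨measureReal_Iic_sub_le L z w, ?_⟩
  simpa only [abs_sub_comm] using measureReal_Iic_sub_le L w z

/-- Changing the stability index, Kolmogorov distance. -/
theorem IsMaxStable.abs_cdf_sub_le_of_index (hN : ∀ x ∈ posSphere N, ∀ j, x j ≤ 1) {α β : ℝ}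
    (hα : 0 < α) (hαβ : α ≤ β) {ν : Measure (posSphere N)} [IsFiniteMeasure ν]
    (hν : MomentConstraints ν) {L L' : Measure (Fin d → ℝ)} [IsProbabilityMeasure L]
    [IsProbabilityMeasure L'] (hL : IsMaxStable α ν L id) (hL' : IsMaxStable β ν L' id)
    {z : Fin d → ℝ} (hz : z ∈ posOrthant d) :
    |L.real (Iic z) - L'.real (Iic z)| ≤ d * (β / α - 1) := by
  have hw : (fun j => z j ^ (β / α)) ∈ posOrthant d := fun j => Real.rpow_pos_of_pos (hz j) _
  have h1 : L'.real (Iic z) = L.real (Iic fun j => z j ^ (β / α)) := by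
    rw [measureReal_def, measureReal_def, hL'.apply_Iic (hα.trans_le hαβ) hz, hL.apply_Iic hα hw,
      tail_rpow hα ν hz]
  have h2 : ∀ j {t : ℝ}, 0 < t → L.real {x | x j ≤ t} = Real.exp (-t ^ (-α)) := by
    intro j t ht
    rw [measureReal_def, hL.apply_eval_le hN hα hν, frechet_Iic hα ht,
      ENNReal.toReal_ofReal (Real.exp_pos _).le]
  rw [h1]
  refine (abs_measureReal_Iic_sub_le L _ _).trans ?_
  calc _ ≤ ∑ _j : Fin d, (β / α - 1) := by
        refine Finset.sum_le_sum fun j _ => ?_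
        rw [h2 j (hz j), h2 j (hw j)]
        have h3 : (z j ^ (β / α)) ^ (-α) = (z j ^ (-α)) ^ (β / α) := by
          rw [← Real.rpow_mul (hz j).le, ← Real.rpow_mul (hz j).le, mul_comm]
        rw [h3]
        exact abs_exp_neg_sub_exp_neg_rpow_le (Real.rpow_pos_of_pos (hz j) _)
          ((one_le_div hα).2 hαβ)
    _ = d * (β / α - 1) := by
        rw [Finset.sum_const, Finset.card_univ, Fintype.card_fin, nsmul_eq_mul]

/-- Changing the angular measure, Kolmogorov distance. -/
theorem IsMaxStable.abs_cdf_sub_le_of_angular (hN : ∀ x ∈ posSphere N, ∀ j, x j ≤ 1) {α : ℝ}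
    (hα : 0 < α) {ν₁ ν₂ : Measure (posSphere N)} [IsFiniteMeasure ν₁] [IsFiniteMeasure ν₂]
    (hν₁ : MomentConstraints ν₁) (hν₂ : MomentConstraints ν₂)
    {L₁ L₂ : Measure (Fin d → ℝ)} [IsProbabilityMeasure L₁]
    [IsProbabilityMeasure L₂] (hL₁ : IsMaxStable α ν₁ L₁ id) (hL₂ : IsMaxStable α ν₂ L₂ id)
    {z : Fin d → ℝ} (hz : z ∈ posOrthant d) :
    ENNReal.ofReal |L₁.real (Iic z) - L₂.real (Iic z)| ≤ d * tvDist ν₁ ν₂ := by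
  rw [measureReal_def, measureReal_def, hL₁.apply_Iic hα hz, hL₂.apply_Iic hα hz,
    ENNReal.toReal_ofReal (Real.exp_pos _).le, ENNReal.toReal_ofReal (Real.exp_pos _).le]
  rcases isEmpty_or_nonempty (Fin d) with hd | hd
  · simp [tail]
  -- The same `m` bounds both tails from below and, times the masses of `a` and `b`, bounds their
  -- difference from above.
  obtain ⟨j₀, hj₀⟩ := Finite.exists_max fun j => z j ^ (-α)
  set m := z j₀ ^ (-α)
  have hm : 0 < m := Real.rpow_pos_of_pos (hz j₀) _
  obtain ⟨a, b, _, _, hab, htv⟩ := exists_add_eq_add_tvDist ν₁ ν₂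
  have hsum : (tail α ν₁ z).toReal + (tail α b z).toReal
      = (tail α ν₂ z).toReal + (tail α a z).toReal := by
    rw [← ENNReal.toReal_add (tail_ne_top hN _ _ _) (tail_ne_top hN _ _ _),
      ← ENNReal.toReal_add (tail_ne_top hN _ _ _) (tail_ne_top hN _ _ _), ← tail_add, ← tail_add,
      hab]
  have hle : ∀ κ : Measure (posSphere N), IsFiniteMeasure κ →
      (tail α κ z).toReal ≤ m * κ.real univ := by
    intro κ _
    have := tail_le hN κ (α := α) hj₀
    rw [← ofReal_measureReal (μ := κ) (s := univ), ← ENNReal.ofReal_mul hm.le] at this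
    exact ENNReal.toReal_le_of_le_ofReal (mul_nonneg hm.le measureReal_nonneg) this
  have h1 := (ENNReal.ofReal_le_iff_le_toReal (tail_ne_top hN ν₁ α z)).1 (le_tail hν₁ j₀)
  have h2 := (ENNReal.ofReal_le_iff_le_toReal (tail_ne_top hN ν₂ α z)).1 (le_tail hν₂ j₀)
  have h3 : |(tail α ν₁ z).toReal - (tail α ν₂ z).toReal| ≤ m * (a.real univ + b.real univ) := by
    have ha := hle a inferInstance
    have hb := hle b inferInstance
    have ha0 : 0 ≤ m * a.real univ := mul_nonneg hm.le measureReal_nonneg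
    have hb0 : 0 ≤ m * b.real univ := mul_nonneg hm.le measureReal_nonneg
    have ht1 : 0 ≤ (tail α a z).toReal := ENNReal.toReal_nonneg
    have ht2 : 0 ≤ (tail α b z).toReal := ENNReal.toReal_nonneg
    rw [abs_le]
    constructor <;> linarith
  have h4 := abs_exp_neg_sub_exp_neg_le h1 h2
  have h5 : |Real.exp (-(tail α ν₁ z).toReal) - Real.exp (-(tail α ν₂ z).toReal)|
      ≤ a.real univ + b.real univ := by
    refine h4.trans ?_
    calc _ ≤ Real.exp (-m) * (m * (a.real univ + b.real univ)) := by gcongr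
      _ = (m * Real.exp (-m)) * (a.real univ + b.real univ) := by ring
      _ ≤ _ := mul_le_of_le_one_left (add_nonneg measureReal_nonneg measureReal_nonneg)
          (mul_exp_neg_le_one m)
  refine (ENNReal.ofReal_le_ofReal h5).trans ?_
  rw [ENNReal.ofReal_add measureReal_nonneg measureReal_nonneg, ofReal_measureReal,
    ofReal_measureReal, htv]
  -- The bound obtained is `tvDist ν₁ ν₂` itself; the factor `d ≥ 1` is slack.
  refine le_mul_of_one_le_left zero_le ?_
  have : 0 < d := Fin.pos_iff_nonempty.2 hd
  exact_mod_cast this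

/-! ### Wasserstein distance -/

theorem ofReal_abs_integral_sub_le {Ω : Type*} [MeasurableSpace Ω] {P : Measure Ω}
    {g : (Fin d → ℝ) → ℝ} (hgm : Measurable g) (hg : ∀ x y, |g x - g y| ≤ ∑ j, |x j - y j|)
    {X Y : Ω → Fin d → ℝ} (hX : Measurable X) (hY : Measurable Y)
    (hgX : Integrable (fun ω => g (X ω)) P) :
    ENNReal.ofReal |∫ ω, g (X ω) ∂P - ∫ ω, g (Y ω) ∂P|
      ≤ ∑ j, ∫⁻ ω, ENNReal.ofReal |X ω j - Y ω j| ∂P := by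
  have hm : ∀ j, Measurable fun ω => ENNReal.ofReal |X ω j - Y ω j| := fun j =>
    (((measurable_pi_apply j).comp hX).sub ((measurable_pi_apply j).comp hY)).abs.ennreal_ofReal
  have hle : ∫⁻ ω, ‖g (X ω) - g (Y ω)‖ₑ ∂P ≤ ∑ j, ∫⁻ ω, ENNReal.ofReal |X ω j - Y ω j| ∂P := by
    rw [← lintegral_finsetSum _ fun j _ => hm j]
    refine lintegral_mono fun ω => ?_
    rw [← ENNReal.ofReal_sum_of_nonneg fun j _ => abs_nonneg _, Real.enorm_eq_ofReal_abs]
    exact ENNReal.ofReal_le_ofReal (hg _ _)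
  -- If the right side is finite, integrability passes from `g ∘ X` to `g ∘ Y`, which is needed to
  -- subtract the Bochner integrals.
  by_cases htop : ∑ j, ∫⁻ ω, ENNReal.ofReal |X ω j - Y ω j| ∂P = ∞
  · rw [htop]; exact le_top
  have hint : Integrable (fun ω => g (X ω) - g (Y ω)) P :=
    ⟨((hgm.comp hX).sub (hgm.comp hY)).aestronglyMeasurable,
      hle.trans_lt (lt_top_iff_ne_top.2 htop)⟩
  have hgY : Integrable (fun ω => g (Y ω)) P := by
    exact (hgX.sub hint).congr (Filter.Eventually.of_forall fun ω => sub_sub_cancel _ _)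
  rw [← integral_sub hgX hgY, ← Real.enorm_eq_ofReal_abs]
  exact (enorm_integral_le_lintegral_enorm _).trans hle

/-- The positive part of `b - a` is the length of `[a, b)`; Tonelli and independence do the rest. -/
theorem lintegral_prod_ofReal_sub (L Q : Measure (Fin d → ℝ)) [SFinite L] [SFinite Q]
    (j : Fin d) :
    ∫⁻ p, ENNReal.ofReal (p.2 j - p.1 j) ∂(L.prod Q)
      = ∫⁻ t, L {x | x j ≤ t} * Q {y | t < y j} := by
  set S : Set (((Fin d → ℝ) × (Fin d → ℝ)) × ℝ) := {q | q.1.1 j ≤ q.2 ∧ q.2 < q.1.2 j}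
  have h1 : Measurable fun q : ((Fin d → ℝ) × (Fin d → ℝ)) × ℝ => q.1.1 j :=
    (measurable_pi_apply j).comp (measurable_fst.comp measurable_fst)
  have h2 : Measurable fun q : ((Fin d → ℝ) × (Fin d → ℝ)) × ℝ => q.1.2 j :=
    (measurable_pi_apply j).comp (measurable_snd.comp measurable_fst)
  have hS : MeasurableSet S :=
    (measurableSet_le h1 measurable_snd).inter (measurableSet_lt measurable_snd h2)
  have h3 := Measure.prod_apply (μ := L.prod Q) (ν := (volume : Measure ℝ)) hS
  have h4 := Measure.prod_apply_symm (μ := L.prod Q) (ν := (volume : Measure ℝ)) hS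
  calc _ = ∫⁻ p, volume (Prod.mk p ⁻¹' S) ∂(L.prod Q) :=
        lintegral_congr fun p => (Real.volume_Ico (a := p.1 j) (b := p.2 j)).symm
    _ = ∫⁻ t, (L.prod Q) ((fun p => (p, t)) ⁻¹' S) := h3.symm.trans h4
    _ = _ := by
        refine lintegral_congr fun t => ?_
        rw [← Measure.prod_prod]
        rfl

theorem IsMaxStable.integrable_eval (hN : ∀ x ∈ posSphere N, ∀ j, x j ≤ 1) {α : ℝ}
    (hα : 1 < α) {ν : Measure (posSphere N)} [IsFiniteMeasure ν] (hν : MomentConstraints ν)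
    {L : Measure (Fin d → ℝ)} [IsProbabilityMeasure L] (hL : IsMaxStable α ν L id) (j : Fin d) :
    Integrable (fun x => x j) L := by
  refine ⟨(measurable_pi_apply j).aestronglyMeasurable, ?_⟩
  have hpos : 0 ≤ᵐ[L] fun x => x j := by
    filter_upwards [hL.pos] with x hx using (hx j).le
  rw [hasFiniteIntegral_iff_ofReal hpos]
  have := lintegral_map (μ := L) (f := ENNReal.ofReal) (by fun_prop) (measurable_pi_apply j)
  rw [← this, hL.map_eval hN (by linarith) hν, lintegral_id_frechet hα]
  exact ENNReal.ofReal_lt_top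

theorem IsMaxStable.integrable_of_lipschitz (hN : ∀ x ∈ posSphere N, ∀ j, x j ≤ 1) {α : ℝ}
    (hα : 1 < α) {ν : Measure (posSphere N)} [IsFiniteMeasure ν] (hν : MomentConstraints ν)
    {L : Measure (Fin d → ℝ)} [IsProbabilityMeasure L] (hL : IsMaxStable α ν L id)
    {g : (Fin d → ℝ) → ℝ} (hgm : Measurable g) (hg : ∀ x y, |g x - g y| ≤ ∑ j, |x j - y j|) :
    Integrable g L := by
  have h1 : Integrable (fun x : Fin d → ℝ => |g 0| + ∑ j, |x j|) L :=
    (integrable_const _).add (integrable_finsetSum _ fun j _ =>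
      (hL.integrable_eval hN hα hν j).abs)
  refine h1.mono' hgm.aestronglyMeasurable (Filter.Eventually.of_forall fun x => ?_)
  have h2 := hg x 0
  simp only [Pi.zero_apply, sub_zero] at h2
  have h3 := abs_sub_abs_le_abs_sub (g x) (g 0)
  rw [Real.norm_eq_abs]
  linarith

/-- Bounds the mean overshoot of `Q` above `L` in coordinate `j`. Levels `t ≤ 0` contribute nothing
and those in `(0, δ]` at most `δ`. Above `δ`, `1 - e^(-s) ≤ s` gives the integrand `exp (-t^(-α))
t^(-α) κ(univ)`, and `lintegral_rpow_mul_exp_le` applies. -/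
theorem IsMaxStable.lintegral_prod_ofReal_sub_le (hN : ∀ x ∈ posSphere N, ∀ j, x j ≤ 1) {α : ℝ}
    (hα : 1 < α) {ν κ : Measure (posSphere N)} [IsFiniteMeasure ν]
    (hν : MomentConstraints ν) [IsFiniteMeasure κ]
    {L Q : Measure (Fin d → ℝ)} [IsProbabilityMeasure L] [IsProbabilityMeasure Q]
    (hL : IsMaxStable α ν L id) {δ : ℝ}
    (hQ : ∀ z, (fun _ => δ) ≤ z → Q (Iic z) = ENNReal.ofReal (Real.exp (-(tail α κ z).toReal)))
    (j : Fin d) :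
    ∫⁻ p, ENNReal.ofReal (p.2 j - p.1 j) ∂(L.prod Q)
      ≤ ENNReal.ofReal δ + ENNReal.ofReal (Real.Gamma (1 - 1 / α)) * κ univ := by
  have hα0 : 0 < α := by linarith
  have hQt : ∀ t, δ ≤ t → Q {y | t < y j} ≤ ENNReal.ofReal (t ^ (-α)) * κ univ := by
    intro t ht
    have h1 : {y : Fin d → ℝ | t < y j} ⊆ (Iic fun _ => t)ᶜ := fun y hy h =>
      not_le.2 (show t < y j from hy) ((show y ≤ _ from h) j)
    refine (measure_mono h1).trans ?_
    rw [prob_compl_eq_one_sub measurableSet_Iic, hQ _ fun _ => ht, ← ENNReal.ofReal_one,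
      ← ENNReal.ofReal_sub _ (Real.exp_pos _).le]
    refine le_trans ?_ (tail_le hN κ (z := fun _ => t) fun _ => le_rfl)
    rw [← ENNReal.ofReal_toReal (tail_ne_top hN κ α fun _ => t)]
    refine ENNReal.ofReal_le_ofReal ?_
    rw [ENNReal.ofReal_toReal (tail_ne_top hN κ α fun _ => t)]
    linarith [Real.add_one_le_exp (-(tail α κ fun _ => t).toReal)]
  rw [lintegral_prod_ofReal_sub]
  calc ∫⁻ t, L {x | x j ≤ t} * Q {y | t < y j}
      ≤ ∫⁻ t, ((Ioc 0 δ).indicator 1 t + (Ioi 0).indicator (fun t =>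
          ENNReal.ofReal (Real.exp (-t ^ (-α)) * t ^ (-α)) * κ univ) t) := by
        refine lintegral_mono fun t => ?_
        rcases le_or_gt t 0 with h0 | h0
        · simp only [hL.apply_eval_le_of_nonpos h0, zero_mul]
          exact zero_le
        rcases le_or_gt t δ with h1 | h1
        · refine le_trans ?_ le_self_add
          rw [indicator_of_mem (show t ∈ Ioc 0 δ from ⟨h0, h1⟩)]
          exact mul_le_one' prob_le_one prob_le_one
        · refine le_trans ?_ le_add_self
          rw [indicator_of_mem (show t ∈ Ioi (0 : ℝ) from h0), hL.apply_eval_le hN hα0 hν,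
            frechet_Iic hα0 h0, ENNReal.ofReal_mul (Real.exp_pos _).le, mul_assoc]
          gcongr
          exact hQt t h1.le
    _ ≤ _ := by
        rw [lintegral_add_left (measurable_one.indicator measurableSet_Ioc),
          lintegral_indicator_one measurableSet_Ioc, Real.volume_Ioc, sub_zero,
          lintegral_indicator measurableSet_Ioi, lintegral_mul_const _ (by fun_prop)]
        gcongr
        exact lintegral_rpow_mul_exp_le hα

/-- Adding an independent truncated max-stable vector to a max-stable one. -/
theorem IsMaxStable.ofReal_abs_integral_sub_sup_le (hN : ∀ x ∈ posSphere N, ∀ j, x j ≤ 1) {α : ℝ}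
    (hα : 1 < α) {ν κ : Measure (posSphere N)} [IsFiniteMeasure ν]
    (hν : MomentConstraints ν) [IsFiniteMeasure κ]
    {L Q : Measure (Fin d → ℝ)} [IsProbabilityMeasure L] [IsProbabilityMeasure Q]
    (hL : IsMaxStable α ν L id) {δ : ℝ}
    (hQ : ∀ z, (fun _ => δ) ≤ z → Q (Iic z) = ENNReal.ofReal (Real.exp (-(tail α κ z).toReal)))
    {g : (Fin d → ℝ) → ℝ} (hgm : Measurable g) (hg : ∀ x y, |g x - g y| ≤ ∑ j, |x j - y j|) :
    ENNReal.ofReal |∫ x, g x ∂L - ∫ x, g x ∂((L.prod Q).map fun p => p.1 ⊔ p.2)|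
      ≤ d * (ENNReal.ofReal δ + ENNReal.ofReal (Real.Gamma (1 - 1 / α)) * κ univ) := by
  have hint := hL.integrable_of_lipschitz hN hα hν hgm hg
  have h1 : ∫ x, g x ∂L = ∫ p, g p.1 ∂(L.prod Q) := by
    rw [integral_fun_fst]
    simp
  rw [integral_map measurable_sup_pi.aemeasurable hgm.aestronglyMeasurable, h1]
  refine (ofReal_abs_integral_sub_le hgm hg measurable_fst measurable_sup_pi
    (hint.comp_fst Q)).trans ?_
  calc _ ≤ ∑ _j : Fin d, (ENNReal.ofReal δ
          + ENNReal.ofReal (Real.Gamma (1 - 1 / α)) * κ univ) := by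
        refine Finset.sum_le_sum fun j _ => ?_
        refine le_trans (lintegral_mono fun p => ?_)
          (hL.lintegral_prod_ofReal_sub_le hN hα hν hQ j)
        change ENNReal.ofReal |p.1 j - max (p.1 j) (p.2 j)| ≤ _
        rcases le_total (p.1 j) (p.2 j) with h | h
        · rw [max_eq_right h, abs_sub_comm, abs_of_nonneg (sub_nonneg.2 h)]
        · simp [max_eq_left h]
    _ = _ := by rw [Finset.sum_const, Finset.card_univ, Fintype.card_fin, nsmul_eq_mul]

theorem IsMaxStable.map_sup_apply_Iic {α : ℝ} (hα : 0 < α)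
    (hN : ∀ x ∈ posSphere N, ∀ j, x j ≤ 1) {ν κ : Measure (posSphere N)} [IsFiniteMeasure ν]
    [IsFiniteMeasure κ] {L Q : Measure (Fin d → ℝ)} [IsProbabilityMeasure L]
    [IsProbabilityMeasure Q] (hL : IsMaxStable α ν L id) {δ : Fin d → ℝ} (hδ : δ ∈ posOrthant d)
    (hQ : ∀ z, δ ≤ z → Q (Iic z) = ENNReal.ofReal (Real.exp (-(tail α κ z).toReal)))
    (hQ0 : ∀ z, ¬ δ ≤ z → Q (Iic z) = 0) (z : Fin d → ℝ) :
    ((L.prod Q).map fun p => p.1 ⊔ p.2) (Iic z)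
      = {z | δ ≤ z}.indicator (fun z => ENNReal.ofReal (Real.exp (-(tail α (ν + κ) z).toReal))) z := by
  have hpre : (fun p : (Fin d → ℝ) × (Fin d → ℝ) => p.1 ⊔ p.2) ⁻¹' Iic z = Iic z ×ˢ Iic z := by
    ext p
    exact (sup_le_iff : p.1 ⊔ p.2 ≤ z ↔ _)
  rw [Measure.map_apply measurable_sup_pi measurableSet_Iic, hpre, Measure.prod_prod]
  by_cases h : δ ≤ z
  · rw [indicator_of_mem (show z ∈ {z | δ ≤ z} from h), hQ z h,
      hL.apply_Iic hα fun j => (hδ j).trans_le (h j), ← ENNReal.ofReal_mul (Real.exp_pos _).le,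
      ← Real.exp_add, tail_add, ENNReal.toReal_add (tail_ne_top hN _ _ _) (tail_ne_top hN _ _ _)]
    congr 2
    ring
  · rw [indicator_of_notMem (show z ∉ {z | δ ≤ z} from h), hQ0 z h, mul_zero]

/-- Changing the angular measure, Wasserstein distance. -/
theorem IsMaxStable.ofReal_abs_integral_sub_le_of_angular (hN : ∀ x ∈ posSphere N, ∀ j, x j ≤ 1)
    {α : ℝ} (hα : 1 < α) {ν₁ ν₂ : Measure (posSphere N)} [IsFiniteMeasure ν₁] [IsFiniteMeasure ν₂]
    (hν₁ : MomentConstraints ν₁) (hν₂ : MomentConstraints ν₂)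
    {L₁ L₂ : Measure (Fin d → ℝ)} [IsProbabilityMeasure L₁]
    [IsProbabilityMeasure L₂] (hL₁ : IsMaxStable α ν₁ L₁ id) (hL₂ : IsMaxStable α ν₂ L₂ id)
    {g : (Fin d → ℝ) → ℝ} (hgm : Measurable g) (hg : ∀ x y, |g x - g y| ≤ ∑ j, |x j - y j|) :
    ENNReal.ofReal |∫ x, g x ∂L₁ - ∫ x, g x ∂L₂|
      ≤ d * ENNReal.ofReal (Real.Gamma (1 - 1 / α)) * tvDist ν₁ ν₂ := by
  have hα0 : 0 < α := by linarith
  obtain ⟨a, b, _, _, hab, htv⟩ := exists_add_eq_add_tvDist ν₁ ν₂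
  set Γ := ENNReal.ofReal (Real.Gamma (1 - 1 / α))
  have key : ∀ δ : ℝ, 0 < δ → ENNReal.ofReal |∫ x, g x ∂L₁ - ∫ x, g x ∂L₂|
      ≤ d * Γ * tvDist ν₁ ν₂ + 2 * d * ENNReal.ofReal δ := by
    intro δ hδ
    have hδ' : (fun _ => δ) ∈ posOrthant d := fun _ => hδ
    obtain ⟨A, _, hA, hA0⟩ := exists_truncated_maxStable hN hα0 a hδ'
    obtain ⟨B, _, hB, hB0⟩ := exists_truncated_maxStable hN hα0 b hδ'
    have := Measure.isProbabilityMeasure_map (μ := L₁.prod B) measurable_sup_pi.aemeasurable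
    have := Measure.isProbabilityMeasure_map (μ := L₂.prod A) measurable_sup_pi.aemeasurable
    -- Taking independent maxima adds angular measures, and `ν₁ + b = ν₂ + a`. The truncation at `δ`
    -- is the same on both sides.
    have heq : (L₁.prod B).map (fun p => p.1 ⊔ p.2) = (L₂.prod A).map (fun p => p.1 ⊔ p.2) :=
      measure_ext_of_Iic fun z => by
        rw [hL₁.map_sup_apply_Iic hα0 hN hδ' hB hB0, hL₂.map_sup_apply_Iic hα0 hN hδ' hA hA0, hab]
    have h1 := hL₁.ofReal_abs_integral_sub_sup_le hN hα hν₁ hB hgm hg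
    have h2 := hL₂.ofReal_abs_integral_sub_sup_le hN hα hν₂ hA hgm hg
    rw [← heq] at h2
    set M := ∫ x, g x ∂((L₁.prod B).map fun p => p.1 ⊔ p.2)
    have h3 : |∫ x, g x ∂L₁ - ∫ x, g x ∂L₂| ≤ |∫ x, g x ∂L₁ - M| + |∫ x, g x ∂L₂ - M| := by
      have := abs_sub_le (∫ x, g x ∂L₁) M (∫ x, g x ∂L₂)
      rwa [abs_sub_comm M] at this
    calc _ ≤ ENNReal.ofReal |∫ x, g x ∂L₁ - M| + ENNReal.ofReal |∫ x, g x ∂L₂ - M| :=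
          (ENNReal.ofReal_le_ofReal h3).trans ENNReal.ofReal_add_le
      _ ≤ _ := add_le_add h1 h2
      _ = _ := by rw [← htv]; ring
  -- Let `δ` decrease to `0`.
  refine ge_of_tendsto (f := fun δ : ℝ => d * Γ * tvDist ν₁ ν₂ + 2 * d * ENNReal.ofReal δ)
    (x := nhdsWithin 0 (Ioi 0)) ?_ (eventually_mem_nhdsWithin.mono key)
  have h1 : Filter.Tendsto (fun δ : ℝ => 2 * d * ENNReal.ofReal δ) (nhdsWithin 0 (Ioi 0))
      (nhds (2 * d * ENNReal.ofReal 0)) :=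
    ENNReal.Tendsto.const_mul ((ENNReal.continuous_ofReal.tendsto 0).mono_left nhdsWithin_le_nhds)
      (Or.inr (ENNReal.mul_ne_top (by simp) (by simp)))
  simpa using h1.const_add (d * Γ * tvDist ν₁ ν₂)

theorem measurable_max_one_mul_abs_log :
    Measurable fun t : ℝ => ENNReal.ofReal (max 1 t * |Real.log t|) :=
  ((measurable_const.max measurable_id).mul Real.measurable_log.abs).ennreal_ofReal

/-- Changing the stability index, Wasserstein distance. -/
theorem IsMaxStable.ofReal_abs_integral_sub_le_of_index (hN : ∀ x ∈ posSphere N, ∀ j, x j ≤ 1)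
    {α β : ℝ} (hα : 1 < α) (hαβ : α ≤ β) {ν : Measure (posSphere N)} [IsFiniteMeasure ν]
    (hν : MomentConstraints ν) {L : Measure (Fin d → ℝ)} [IsProbabilityMeasure L]
    (hL : IsMaxStable α ν L id) {g : (Fin d → ℝ) → ℝ} (hgm : Measurable g)
    (hg : ∀ x y, |g x - g y| ≤ ∑ j, |x j - y j|) :
    ENNReal.ofReal |∫ x, g x ∂L - ∫ x, g x ∂(L.map fun x j => x j ^ (α / β))|
      ≤ ENNReal.ofReal (1 - α / β) *
        (d * ∫⁻ t, ENNReal.ofReal (max 1 t * |Real.log t|) ∂(frechet α)) := by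
  have hα0 : 0 < α := by linarith
  have hβ0 : 0 < β := by linarith
  have hm : Measurable fun (x : Fin d → ℝ) j => x j ^ (α / β) :=
    measurable_pi_lambda _ fun j => (measurable_pi_apply j).pow_const _
  rw [integral_map hm.aemeasurable hgm.aestronglyMeasurable]
  -- Coupling: both vectors live on `L`, as `x` and its coordinatewise power.
  refine (ofReal_abs_integral_sub_le hgm hg measurable_id hm
    (hL.integrable_of_lipschitz hN hα hν hgm hg)).trans ?_
  have hGm := measurable_max_one_mul_abs_log
  calc _ ≤ ∑ _j : Fin d, ENNReal.ofReal (1 - α / β) *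
          ∫⁻ t, ENNReal.ofReal (max 1 t * |Real.log t|) ∂(frechet α) := by
        refine Finset.sum_le_sum fun j _ => ?_
        rw [← hL.map_eval hN hα0 hν j, lintegral_map hGm (measurable_pi_apply j),
          ← lintegral_const_mul (f := fun x : Fin d → ℝ => ENNReal.ofReal (max 1 (x j) *
            |Real.log (x j)|)) _ (hGm.comp (measurable_pi_apply j))]
        refine lintegral_mono_ae ?_
        filter_upwards [hL.pos] with x hx
        rw [← ENNReal.ofReal_mul (by rw [sub_nonneg, div_le_one hβ0]; exact hαβ)]
        exact ENNReal.ofReal_le_ofReal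
          (abs_sub_rpow_le (hx j) (by positivity) ((div_le_one hβ0).2 hαβ))
    _ = _ := by
        rw [Finset.sum_const, Finset.card_univ, Fintype.card_fin, nsmul_eq_mul, mul_left_comm]

/-! ### The constants -/

theorem minProb_mono (α₁ α₂ : ℝ) : Monotone (minProb α₁ α₂) := fun _ _ h =>
  measure_mono fun _ hx => le_trans hx h

theorem frechet_Iic_le_minProb (α₁ α₂ t : ℝ) : frechet α₁ (Iic t) ≤ minProb α₁ α₂ t :=
  measure_mono fun x hx => (min_le_right (x ^ (α₂ / α₁)) x).trans hx

theorem minProb_le_one {α₁ : ℝ} (h : 0 < α₁) (α₂ t : ℝ) : minProb α₁ α₂ t ≤ 1 :=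
  (measure_mono (subset_univ _)).trans (frechet_univ h).le

/-- For `t ≤ 1`, either alternative in the minimum forces `x ≤ t^(α₁/α₂)`, since `t ≤ t^(α₁/α₂)`.
Hence the probability decays faster than any power as `t → 0`. -/
theorem minProb_le {α₁ α₂ : ℝ} (h₁ : 0 < α₁) (h₁₂ : α₁ ≤ α₂) {t : ℝ} (ht : t ∈ Ioc 0 1) :
    minProb α₁ α₂ t ≤ ENNReal.ofReal (Real.exp (-t ^ (-(α₁ * (α₁ / α₂))))) := by
  have h₂ : 0 < α₂ := h₁.trans_le h₁₂
  have hc : α₁ / α₂ ≤ 1 := (div_le_one h₂).2 h₁₂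
  have hs : 0 < t ^ (α₁ / α₂) := Real.rpow_pos_of_pos ht.1 _
  have hsub : {x : ℝ | min (x ^ (α₂ / α₁)) x ≤ t} ⊆ Iic (t ^ (α₁ / α₂)) := by
    intro x hx
    rcases le_or_gt x 0 with h0 | h0
    · exact h0.trans hs.le
    rcases min_le_iff.1 (show min (x ^ (α₂ / α₁)) x ≤ t from hx) with h | h
    · rw [mem_Iic, ← inv_div α₂ α₁, Real.le_rpow_inv_iff_of_pos h0.le ht.1.le (by positivity)]
      exact h
    · refine h.trans ?_
      simpa using Real.rpow_le_rpow_of_exponent_ge ht.1 ht.2 hc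
  refine (measure_mono hsub).trans ?_
  rw [frechet_Iic h₁ hs, ← Real.rpow_mul ht.1.le]
  refine le_of_eq ?_
  congr 4
  ring

/-- Near `0` the decay of `p` beats every power of `t`; near infinity the growth `t^q log t` with `q
< α` is integrable against `t^(-(α+1))`. It serves `constK` with `q = 0` and `constW` with `q = 1`.
-/
theorem lintegral_log_lt_top {α γ q : ℝ} {m : ℝ → ℝ} {p : ℝ → ℝ≥0∞} (hα : 0 < α) (hγ : 0 < γ)
    (hq : q < α) (hm1 : ∀ t ∈ Ioc (0 : ℝ) 1, m t ≤ 1) (hm2 : ∀ t ∈ Ioi (1 : ℝ), m t ≤ t ^ q)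
    (hp1 : ∀ t, p t ≤ 1) (hp : ∀ t ∈ Ioc (0 : ℝ) 1, p t ≤ ENNReal.ofReal (Real.exp (-t ^ (-γ)))) :
    ∫⁻ t in Ioi (0 : ℝ),
      ENNReal.ofReal (α * t ^ (-(α + 1))) * (ENNReal.ofReal (m t * |Real.log t|) * p t) < ∞ := by
  rw [← Ioc_union_Ioi_eq_Ioi zero_le_one]
  refine (lintegral_union_le _ _ _).trans_lt (ENNReal.add_lt_top.2 ⟨?_, ?_⟩)
  · obtain ⟨n, hn⟩ := exists_nat_ge ((α + 2) / γ)
    have hbd : ∀ t ∈ Ioc (0 : ℝ) 1,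
        ENNReal.ofReal (α * t ^ (-(α + 1))) * (ENNReal.ofReal (m t * |Real.log t|) * p t)
          ≤ ENNReal.ofReal (α * n.factorial) := by
      intro t ht
      have ht0 : 0 < t := ht.1
      refine (mul_le_mul_right (mul_le_mul_right (hp t ht) _) _).trans ?_
      rw [← ENNReal.ofReal_mul' (Real.exp_pos _).le, ← ENNReal.ofReal_mul (by positivity)]
      refine ENNReal.ofReal_le_ofReal ?_
      have h1 : m t * |Real.log t| ≤ t⁻¹ := by
        have h2 := (Real.abs_log_mul_self_lt t ht0 ht.2).le
        rw [abs_mul, abs_of_pos ht0, ← le_div_iff₀ ht0, one_div] at h2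
        exact (mul_le_of_le_one_left (abs_nonneg _) (hm1 t ht)).trans h2
      have hs : 1 ≤ t ^ (-γ) := Real.one_le_rpow_of_pos_of_le_one_of_nonpos ht0 ht.2 (by linarith)
      have h3 : t ^ (-(α + 1)) * t⁻¹ ≤ (t ^ (-γ)) ^ n := by
        rw [← div_eq_mul_inv, ← Real.rpow_sub_one ht0.ne', ← Real.rpow_natCast,
          ← Real.rpow_mul ht0.le]
        refine Real.rpow_le_rpow_of_exponent_ge ht0 ht.2 ?_
        rw [div_le_iff₀ hγ] at hn
        linarith
      have h4 : (t ^ (-γ)) ^ n * Real.exp (-t ^ (-γ)) ≤ n.factorial := by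
        have := Real.pow_div_factorial_le_exp (t ^ (-γ)) (by linarith) n
        rw [Real.exp_neg, ← div_eq_mul_inv, div_le_iff₀ (Real.exp_pos _)]
        rwa [div_le_iff₀ (by positivity), mul_comm] at this
      calc α * t ^ (-(α + 1)) * (m t * |Real.log t| * Real.exp (-t ^ (-γ)))
          ≤ α * t ^ (-(α + 1)) * (t⁻¹ * Real.exp (-t ^ (-γ))) := by gcongr
        _ = α * (t ^ (-(α + 1)) * t⁻¹ * Real.exp (-t ^ (-γ))) := by ring
        _ ≤ α * ((t ^ (-γ)) ^ n * Real.exp (-t ^ (-γ))) := by gcongr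
        _ ≤ α * n.factorial := by gcongr
    refine (setLIntegral_mono' measurableSet_Ioc hbd).trans_lt ?_
    rw [setLIntegral_const]
    exact ENNReal.mul_lt_top ENNReal.ofReal_lt_top (by simp)
  · set ε := (α - q) / 2 with hε
    have hε0 : 0 < ε := by rw [hε]; linarith
    have hbd : ∀ t ∈ Ioi (1 : ℝ),
        ENNReal.ofReal (α * t ^ (-(α + 1))) * (ENNReal.ofReal (m t * |Real.log t|) * p t)
          ≤ ENNReal.ofReal (α / ε * t ^ (-1 - ε)) := by
      intro t ht
      have ht1 : 1 < t := ht
      have ht0 : 0 < t := by linarith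
      refine (mul_le_mul_right (mul_le_mul_right (hp1 t) _) _).trans ?_
      rw [mul_one, ← ENNReal.ofReal_mul (by positivity)]
      refine ENNReal.ofReal_le_ofReal ?_
      rw [abs_of_nonneg (Real.log_nonneg ht1.le)]
      have h1 : m t * Real.log t ≤ t ^ q * (t ^ ε / ε) :=
        mul_le_mul (hm2 t ht) (Real.log_le_rpow_div ht0.le hε0) (Real.log_nonneg ht1.le)
          (Real.rpow_nonneg ht0.le _)
      calc α * t ^ (-(α + 1)) * (m t * Real.log t)
          ≤ α * t ^ (-(α + 1)) * (t ^ q * (t ^ ε / ε)) := by gcongr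
        _ = α / ε * (t ^ (-(α + 1)) * t ^ q * t ^ ε) := by ring
        _ = α / ε * t ^ (-1 - ε) := by
            rw [← Real.rpow_add ht0, ← Real.rpow_add ht0]
            congr 2
            rw [hε]; ring
    refine (setLIntegral_mono' measurableSet_Ioi hbd).trans_lt ?_
    exact ((integrableOn_Ioi_rpow_of_lt (by linarith) one_pos).const_mul _).lintegral_lt_top

theorem constK_lt_top {α₁ α₂ : ℝ} (h₁ : 0 < α₁) (h₁₂ : α₁ ≤ α₂) {ν : Measure (posSphere N)}
    [SFinite ν] (hν : MomentConstraints ν) : constK α₁ α₂ ν < ∞ := by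
  refine ENNReal.add_lt_top.2 ⟨by simp, ENNReal.sum_lt_top.2 fun j _ => ?_⟩
  have hG : Measurable fun t : ℝ => ENNReal.ofReal |Real.log t| * minProb α₁ α₂ t :=
    Real.measurable_log.abs.ennreal_ofReal.mul (minProb_mono α₁ α₂).measurable
  rw [lintegral_exponentMeasure_coord h₁ hν j hG (by simp)]
  have h₂ : 0 < α₂ := h₁.trans_le h₁₂
  simpa using lintegral_log_lt_top (γ := α₁ * (α₁ / α₂)) (q := 0) (m := fun _ => 1) h₁
    (by positivity) h₁ (fun _ _ => le_rfl) (fun t _ => by simp)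
    (minProb_le_one h₁ α₂) (fun t ht => minProb_le h₁ h₁₂ ht)

theorem measurable_constW_integrand (α₁ α₂ : ℝ) : Measurable fun t : ℝ =>
    ENNReal.ofReal (max 1 t * |Real.log t|) * minProb α₁ α₂ t :=
  measurable_max_one_mul_abs_log.mul (minProb_mono α₁ α₂).measurable

theorem constW_lt_top {α₁ α₂ : ℝ} (h₁ : 1 < α₁) (h₁₂ : α₁ ≤ α₂) {ν : Measure (posSphere N)}
    [SFinite ν] (hν : MomentConstraints ν) : constW α₁ α₂ ν < ∞ := by
  have h₀ : 0 < α₁ := by linarith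
  have h₂ : 0 < α₂ := h₀.trans_le h₁₂
  refine ENNReal.add_lt_top.2 ⟨ENNReal.mul_lt_top (by simp) ENNReal.ofReal_lt_top,
    ENNReal.sum_lt_top.2 fun j _ => ?_⟩
  rw [lintegral_exponentMeasure_coord h₀ hν j (measurable_constW_integrand α₁ α₂) (by simp)]
  exact lintegral_log_lt_top (γ := α₁ * (α₁ / α₂)) (q := 1) h₀
    (by positivity) h₁ (fun t ht => max_le le_rfl ht.2)
    (fun t ht => by rw [Real.rpow_one]; exact max_le (mem_Ioi.1 ht).le le_rfl)
    (minProb_le_one h₀ α₂) (fun t ht => minProb_le h₀ h₁₂ ht)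

/-- The Fréchet density is the marginal density `α t^(-(α+1))` of `μ` times `P(Z ≤ t)`, which is at
most `minProb`. The Gamma term of `constW` is not needed here. -/
theorem mul_lintegral_frechet_le_constW {α₁ α₂ : ℝ} (h₁ : 0 < α₁)
    {ν : Measure (posSphere N)} [SFinite ν] (hν : MomentConstraints ν) :
    d * ∫⁻ t, ENNReal.ofReal (max 1 t * |Real.log t|) ∂(frechet α₁) ≤ constW α₁ α₂ ν := by
  refine le_trans ?_ le_add_self
  calc _ = ∑ _j : Fin d, ∫⁻ t, ENNReal.ofReal (max 1 t * |Real.log t|) ∂(frechet α₁) := by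
        rw [Finset.sum_const, Finset.card_univ, Fintype.card_fin, nsmul_eq_mul]
    _ ≤ _ := by
        refine Finset.sum_le_sum fun j _ => ?_
        rw [lintegral_exponentMeasure_coord h₁ hν j (measurable_constW_integrand α₁ α₂) (by simp),
          lintegral_frechet measurable_max_one_mul_abs_log]
        refine setLIntegral_mono' measurableSet_Ioi fun t ht => ?_
        have ht : 0 < t := ht
        rw [ENNReal.ofReal_mul (by positivity), ← frechet_Iic h₁ ht, mul_assoc,
          mul_comm (frechet α₁ (Iic t))]
        gcongr
        exact frechet_Iic_le_minProb α₁ α₂ t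

/-! ### The distances -/

/-- The right side equals `α₂/α₁ - α₁/α₂`, and `α₁/α₂ ≤ 1 ≤ α₂/α₁`. -/
theorem index_factor {α₁ α₂ : ℝ} (h₁ : 0 < α₁) (h₁₂ : α₁ < α₂) :
    α₂ / α₁ - 1 ≤ (1 / α₁ + 1 / α₂) * |α₁ - α₂| ∧
      1 - α₁ / α₂ ≤ (1 / α₁ + 1 / α₂) * |α₁ - α₂| := by
  have h₂ : 0 < α₂ := h₁.trans h₁₂
  have hle : α₁ / α₂ ≤ 1 := (div_le_one h₂).2 h₁₂.le
  have hge : 1 ≤ α₂ / α₁ := (one_le_div h₁).2 h₁₂.le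
  have h : (1 / α₁ + 1 / α₂) * |α₁ - α₂| = α₂ / α₁ - α₁ / α₂ := by
    rw [abs_of_neg (by linarith)]
    field_simp
    ring
  rw [h]
  constructor <;> linarith

theorem measurable_rpow_pi (c : ℝ) : Measurable fun (x : Fin d → ℝ) j => x j ^ c :=
  measurable_pi_lambda _ fun j => (measurable_pi_apply j).pow_const _

/-- Test functions are controlled only on the orthant. Composing with the positive part makes them
Lipschitz, hence measurable, on all of `ℝ^d`, and does not change expectations of positive vectors.
-/
theorem abs_comp_sup_zero_sub_le {h : (Fin d → ℝ) → ℝ} (hh : h ∈ lipOne d) (x y : Fin d → ℝ) :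
    |h (x ⊔ 0) - h (y ⊔ 0)| ≤ ∑ j, |x j - y j| :=
  (hh _ (fun _ => le_max_right _ _) _ (fun _ => le_max_right _ _)).trans
    (Finset.sum_le_sum fun j _ => abs_max_sub_max_le_abs (x j) (y j) 0)

theorem measurable_of_abs_sub_le {g : (Fin d → ℝ) → ℝ} (hg : ∀ x y, |g x - g y| ≤ ∑ j, |x j - y j|) :
    Measurable g := by
  have : LipschitzWith d g := LipschitzWith.of_dist_le_mul fun x y => by
    rw [Real.dist_eq]
    refine (hg x y).trans ?_
    calc ∑ j, |x j - y j| ≤ ∑ _j : Fin d, dist x y :=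
          Finset.sum_le_sum fun j _ => by rw [← Real.dist_eq]; exact dist_le_pi_dist x y j
      _ = _ := by simp
  exact this.continuous.measurable

theorem IsMaxStable.integral_comp {Ω : Type*} [MeasurableSpace Ω] {P : Measure Ω}
    {Z : Ω → Fin d → ℝ} {α : ℝ} {ν : Measure (posSphere N)}
    {h : (Fin d → ℝ) → ℝ} (hm : Measurable fun x => h (x ⊔ 0)) (hZ : IsMaxStable α ν P Z) :
    ∫ ω, h (Z ω) ∂P = ∫ x, h (x ⊔ 0) ∂(P.map Z) := by
  rw [integral_map hZ.aemeasurable hm.aestronglyMeasurable]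
  refine integral_congr_ae ?_
  filter_upwards [hZ.pos] with ω hω
  have : (Z ω) ⊔ 0 = Z ω := sup_eq_left.2 fun j => (hω j).le
  rw [this]

variable {Ω₁ Ω₂ : Type*} [MeasurableSpace Ω₁] [MeasurableSpace Ω₂]
  {P₁ : Measure Ω₁} {P₂ : Measure Ω₂} [IsProbabilityMeasure P₁] [IsProbabilityMeasure P₂]
  {Z₁ : Ω₁ → Fin d → ℝ} {Z₂ : Ω₂ → Fin d → ℝ} {α₁ α₂ : ℝ}
  {ν₁ ν₂ : Measure (posSphere N)} [IsFiniteMeasure ν₁] [IsFiniteMeasure ν₂]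

theorem kolmogorovDist_le (hN : ∀ x ∈ posSphere N, ∀ j, x j ≤ 1) (h₁ : 0 < α₁) (h₁₂ : α₁ < α₂)
    (hν₁ : MomentConstraints ν₁) (hν₂ : MomentConstraints ν₂)
    (hZ₁ : IsMaxStable α₁ ν₁ P₁ Z₁) (hZ₂ : IsMaxStable α₂ ν₂ P₂ Z₂) :
    kolmogorovDist P₁ Z₁ P₂ Z₂ ≤
      constK α₁ α₂ ν₁ * ENNReal.ofReal ((1 / α₁ + 1 / α₂) * |α₁ - α₂|) + d * tvDist ν₁ ν₂ := by
  have h₂ : 0 < α₂ := h₁.trans h₁₂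
  have hL₁ := hZ₁.map
  have hL₂ := hZ₂.map
  have := Measure.isProbabilityMeasure_map hZ₁.aemeasurable
  have := Measure.isProbabilityMeasure_map hZ₂.aemeasurable
  have hL := hL₁.map_rpow h₁ h₂
  have := Measure.isProbabilityMeasure_map (μ := P₁.map Z₁)
    (measurable_rpow_pi (d := d) (α₁ / α₂)).aemeasurable
  set L := (P₁.map Z₁).map fun (x : Fin d → ℝ) j => x j ^ (α₁ / α₂)
  refine iSup₂_le fun z hz => ?_
  have e₁ : P₁.real {ω | Z₁ ω ≤ z} = (P₁.map Z₁).real (Iic z) :=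
    (map_measureReal_apply_of_aemeasurable hZ₁.aemeasurable measurableSet_Iic).symm
  have e₂ : P₂.real {ω | Z₂ ω ≤ z} = (P₂.map Z₂).real (Iic z) :=
    (map_measureReal_apply_of_aemeasurable hZ₂.aemeasurable measurableSet_Iic).symm
  rw [e₁, e₂]
  refine (ENNReal.ofReal_le_ofReal (abs_sub_le _ (L.real (Iic z)) _)).trans
    (ENNReal.ofReal_add_le.trans (add_le_add ?_
      (hL.abs_cdf_sub_le_of_angular hN h₂ hν₁ hν₂ hL₂ hz)))
  refine (ENNReal.ofReal_le_ofReal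
    (hL₁.abs_cdf_sub_le_of_index hN h₁ h₁₂.le hν₁ hL hz)).trans ?_
  -- Only the summand `d` of `constK` is used.
  rw [ENNReal.ofReal_mul (Nat.cast_nonneg d), ENNReal.ofReal_natCast]
  exact mul_le_mul' le_self_add (ENNReal.ofReal_le_ofReal (index_factor h₁ h₁₂).1)

theorem wassersteinDist_le (hN : ∀ x ∈ posSphere N, ∀ j, x j ≤ 1) (h₁ : 1 < α₁) (h₁₂ : α₁ < α₂)
    (hν₁ : MomentConstraints ν₁) (hν₂ : MomentConstraints ν₂)
    (hZ₁ : IsMaxStable α₁ ν₁ P₁ Z₁) (hZ₂ : IsMaxStable α₂ ν₂ P₂ Z₂) :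
    wassersteinDist P₁ Z₁ P₂ Z₂ ≤
      constW α₁ α₂ ν₁ * ENNReal.ofReal ((1 / α₁ + 1 / α₂) * |α₁ - α₂|)
        + d * ENNReal.ofReal (Real.Gamma (1 - 1 / α₂)) * tvDist ν₁ ν₂ := by
  have h₀ : 0 < α₁ := by linarith
  have h₂ : 0 < α₂ := h₀.trans h₁₂
  have hL₁ := hZ₁.map
  have hL₂ := hZ₂.map
  have := Measure.isProbabilityMeasure_map hZ₁.aemeasurable
  have := Measure.isProbabilityMeasure_map hZ₂.aemeasurable
  have hL := hL₁.map_rpow h₀ h₂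
  have := Measure.isProbabilityMeasure_map (μ := P₁.map Z₁)
    (measurable_rpow_pi (d := d) (α₁ / α₂)).aemeasurable
  refine iSup₂_le fun h hh => ?_
  have hg := abs_comp_sup_zero_sub_le hh
  have hgm := measurable_of_abs_sub_le hg
  rw [hZ₁.integral_comp hgm, hZ₂.integral_comp hgm]
  refine (ENNReal.ofReal_le_ofReal (abs_sub_le _ (∫ x, h (x ⊔ 0)
    ∂((P₁.map Z₁).map fun (x : Fin d → ℝ) j => x j ^ (α₁ / α₂))) _)).trans
    (ENNReal.ofReal_add_le.trans (add_le_add ?_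
      (hL.ofReal_abs_integral_sub_le_of_angular hN (h₁.trans h₁₂) hν₁ hν₂ hL₂ hgm hg)))
  refine (hL₁.ofReal_abs_integral_sub_le_of_index hN h₁ h₁₂.le hν₁ hgm hg).trans ?_
  rw [mul_comm]
  exact mul_le_mul' (mul_lintegral_frechet_le_constW h₀ hν₁)
    (ENNReal.ofReal_le_ofReal (index_factor h₀ h₁₂).2)

end MaxStable

theorem mainTheorem6 {d : ℕ} (N : Seminorm ℝ (Fin d → ℝ)) (hN : ∀ x, N x = 0 → x = 0)
    (hN_le : ∀ x ∈ MaxStable.posSphere N, ∀ j, x j ≤ 1)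
    (α₁ α₂ : ℝ) (hα₁ : 0 < α₁) (hα₁₂ : α₁ < α₂)
    (ν₁ ν₂ : Measure (MaxStable.posSphere N)) [IsFiniteMeasure ν₁] [IsFiniteMeasure ν₂]
    (hν₁ : MaxStable.MomentConstraints ν₁) (hν₂ : MaxStable.MomentConstraints ν₂)
    {Ω₁ Ω₂ : Type*} [MeasurableSpace Ω₁] [MeasurableSpace Ω₂]
    (P₁ : Measure Ω₁) (P₂ : Measure Ω₂) [IsProbabilityMeasure P₁] [IsProbabilityMeasure P₂]
    (Z₁ : Ω₁ → Fin d → ℝ) (Z₂ : Ω₂ → Fin d → ℝ)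
    (hZ₁ : MaxStable.IsMaxStable α₁ ν₁ P₁ Z₁) (hZ₂ : MaxStable.IsMaxStable α₂ ν₂ P₂ Z₂) :
    (MaxStable.constK α₁ α₂ ν₁ < ∞ ∧
      MaxStable.kolmogorovDist P₁ Z₁ P₂ Z₂ ≤
        MaxStable.constK α₁ α₂ ν₁ * ENNReal.ofReal ((1 / α₁ + 1 / α₂) * |α₁ - α₂|)
          + d * MaxStable.tvDist ν₁ ν₂) ∧
    (1 < α₁ →
      MaxStable.constW α₁ α₂ ν₁ < ∞ ∧
      MaxStable.wassersteinDist P₁ Z₁ P₂ Z₂ ≤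
        MaxStable.constW α₁ α₂ ν₁ * ENNReal.ofReal ((1 / α₁ + 1 / α₂) * |α₁ - α₂|)
          + d * ENNReal.ofReal (Real.Gamma (1 - 1 / α₂)) * MaxStable.tvDist ν₁ ν₂ ∧
      MaxStable.smoothWassersteinDist P₁ Z₁ P₂ Z₂ ≤
        MaxStable.constW α₁ α₂ ν₁ * ENNReal.ofReal ((1 / α₁ + 1 / α₂) * |α₁ - α₂|)
          + d * ENNReal.ofReal (Real.Gamma (1 - 1 / α₂)) * MaxStable.tvDist ν₁ ν₂) := by
  refine ⟨⟨MaxStable.constK_lt_top hα₁ hα₁₂.le hν₁,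
    MaxStable.kolmogorovDist_le hN_le hα₁ hα₁₂ hν₁ hν₂ hZ₁ hZ₂⟩, fun h => ?_⟩
  have hW := MaxStable.wassersteinDist_le hN_le h hα₁₂ hν₁ hν₂ hZ₁ hZ₂
  exact ⟨MaxStable.constW_lt_top h hα₁₂.le hν₁, hW,
    (biSup_mono fun _ hh => hh.2).trans hW⟩
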